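/- Let $\mathbb D$ be the open unit disc and let $\mathcal N$ (the Nevanlinna class) be the algebra of holomorphic functions $f$ on $\mathbb D$ such that $\log|f|\le h$ on $\mathbb D$ for some nonnegative harmonic function $h$ on $\mathbb D$. A tuple in a commutative ring $A$ is called unimodular if the ideal it generates is $A$. A unimodular tuple $(f_1,\dots,f_{n+1})$ is called reducible if there are $h_1,\dots,h_n\in A$ such that $(f_1+h_1f_{n+1},\dots,f_n+h_nf_{n+1})$ is unimodular. The Bass stable rank of $A$ is the smallest integer $n\ge 1$ such that every unimodular $(n+1)$-tuple in $A$ is reducible ($\infty$ if there is none). **Proposition.** The Bass stable rank of $\mathcal N$ is at least $2$. Explicitly, for $k\ge 1$ let $z_k=1-2^{-k}$, and let $$B_1(z)=\prod_{k\ge1}\frac{\overline{z_k}}{|z_k|}\,\frac{z_k-z}{1-z\overline{z_k}}$$ be the Blaschke product with zeros $(z_k)_{k\ge 1}$. There are points $\mu_k\in(0,1)$, $k\ge1$, with $$\lim_{k\to\infty}\left|\frac{\mu_k-z_k}{1-\mu_k z_k}\right|=0\qquad\text{and}\qquad |B_1(\mu_k)|=\begin{cases}e^{-1/(1-|z_k|^2)}&\text{if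 } k \text{ is even},\\ e^{-2/(1-|z_k|^2)}&\text{if } k \text{ is odd},\end{cases}\qquad k\ge1.$$ For every such sequence $(\mu_k)_{k\ge1}$, with $B_2$ the Blaschke product with zeros $(\mu_k)_{k\ge1}$, the functions $B_1$ and $B_2$ belong to $\mathcal N$, the pair $(B_1,B_2)$ is unimodular in $\mathcal N$, and for no $\varphi\in\mathcal N$ is $B_1+\varphi B_2$ invertible in $\mathcal N$. -/

import Mathlib

open Filter Topology InnerProductSpace
open scoped ComplexConjugate Complex.UnitDisc

noncomputable section

/-! ### Bass stable rank of a commutative ring -/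

/-- A tuple is unimodular if it is contained in no ideal smaller than the whole ring. -/
def IsUnimodularTuple {A : Type*} [CommRing A] {n : ℕ} (f : Fin n → A) : Prop :=
  Ideal.span (Set.range f) = ⊤

/-- `(f₁, …, fₙ, fₙ₊₁)` is reducible if it is unimodular and
`(f₁ + h₁ fₙ₊₁, …, fₙ + hₙ fₙ₊₁)` is unimodular for some `h₁, …, hₙ`. -/
def IsReducibleTuple {A : Type*} [CommRing A] {n : ℕ} (f : Fin (n + 1) → A) : Prop :=
  IsUnimodularTuple f ∧
    ∃ h : Fin n → A, IsUnimodularTuple fun i : Fin n => f i.castSucc + h i * f (Fin.last n)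

/-- The Bass stable rank: the smallest integer `n ≥ 1` such that every unimodular
`(n + 1)`-tuple is reducible, and `⊤` if there is no such integer. -/
def bassStableRank (A : Type*) [CommRing A] : ℕ∞ :=
  sInf {r : ℕ∞ | ∃ n : ℕ, r = n ∧ 1 ≤ n ∧
    ∀ f : Fin (n + 1) → A, IsUnimodularTuple f → IsReducibleTuple f}

/-! ### The Nevanlinna class -/

/-- `h` restricted to the unit disc is a nonnegative harmonic function. -/
def IsPosHarmonic (h : ℂ → ℝ) : Prop :=
  HarmonicOnNhd h (Metric.ball 0 1) ∧ ∀ z : 𝔻, 0 ≤ h z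

/-- `f` is holomorphic on the unit disc and `log |f|` has a positive harmonic majorant there.
At a zero of `f`, where `log |f| = -∞`, the inequality below reads `0 ≤ h z`, which always
holds because `h` is nonnegative. -/
def IsNevanlinna (f : 𝔻 → ℂ) : Prop :=
  (∃ F : ℂ → ℂ, DifferentiableOn ℂ F (Metric.ball 0 1) ∧ ∀ z : 𝔻, F z = f z) ∧
    ∃ h : ℂ → ℝ, IsPosHarmonic h ∧ ∀ z : 𝔻, Real.log ‖f z‖ ≤ h z

theorem IsNevanlinna.const (c : ℂ) : IsNevanlinna fun _ => c := by
  refine ⟨⟨fun _ => c, differentiableOn_const c, fun _ => rfl⟩, fun _ => |Real.log ‖c‖|, ⟨?_, ?_⟩, ?_⟩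
  · exact harmonicOnNhd_const _
  · intro _; positivity
  · intro _; exact le_abs_self _

theorem IsNevanlinna.mul {f g : 𝔻 → ℂ} (hf : IsNevanlinna f) (hg : IsNevanlinna g) :
    IsNevanlinna (f * g) := by
  obtain ⟨⟨F, hF, hFf⟩, h, ⟨hh, hh0⟩, hfh⟩ := hf
  obtain ⟨⟨G, hG, hGg⟩, k, ⟨hk, hk0⟩, hgk⟩ := hg
  refine ⟨⟨F * G, hF.mul hG, fun z => by simp [hFf, hGg]⟩, h + k, ⟨hh.add hk, fun z => ?_⟩, ?_⟩
  · exact add_nonneg (hh0 z) (hk0 z)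
  · intro z
    simp only [Pi.mul_apply, Pi.add_apply, norm_mul]
    by_cases h1 : f z = 0
    · simpa [h1] using add_nonneg (hh0 z) (hk0 z)
    by_cases h2 : g z = 0
    · simpa [h2] using add_nonneg (hh0 z) (hk0 z)
    rw [Real.log_mul (norm_ne_zero_iff.2 h1) (norm_ne_zero_iff.2 h2)]
    exact add_le_add (hfh z) (hgk z)

theorem norm_le_exp_of_log_le {c : ℂ} {t : ℝ} (h : Real.log ‖c‖ ≤ t) : ‖c‖ ≤ Real.exp t := by
  by_cases hc : c = 0
  · simpa [hc] using (Real.exp_pos t).le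
  · exact (Real.log_le_iff_le_exp (norm_pos_iff.2 hc)).1 h

theorem IsNevanlinna.add {f g : 𝔻 → ℂ} (hf : IsNevanlinna f) (hg : IsNevanlinna g) :
    IsNevanlinna (f + g) := by
  obtain ⟨⟨F, hF, hFf⟩, h, ⟨hh, hh0⟩, hfh⟩ := hf
  obtain ⟨⟨G, hG, hGg⟩, k, ⟨hk, hk0⟩, hgk⟩ := hg
  have hlog : 0 ≤ Real.log 2 := Real.log_nonneg one_le_two
  refine ⟨⟨F + G, hF.add hG, fun z => by simp [hFf, hGg]⟩, (fun _ => Real.log 2) + (h + k),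
    ⟨(harmonicOnNhd_const _).add (hh.add hk), fun z => ?_⟩, ?_⟩
  · exact add_nonneg hlog (add_nonneg (hh0 z) (hk0 z))
  · intro z
    simp only [Pi.add_apply]
    by_cases h0 : f z + g z = 0
    · simpa [h0] using add_nonneg hlog (add_nonneg (hh0 z) (hk0 z))
    rw [Real.log_le_iff_le_exp (norm_pos_iff.2 h0), Real.exp_add, Real.exp_log two_pos]
    have h1 := norm_le_exp_of_log_le (hfh z)
    have h2 := norm_le_exp_of_log_le (hgk z)
    have h3 : Real.exp (h z) ≤ Real.exp (h z + k z) := Real.exp_le_exp.2 (by linarith [hk0 z])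
    have h4 : Real.exp (k z) ≤ Real.exp (h z + k z) := Real.exp_le_exp.2 (by linarith [hh0 z])
    linarith [norm_add_le (f z) (g z)]

/-- The Nevanlinna class, as an algebra of functions on the unit disc under pointwise
operations. -/
def nevanlinnaClass : Subalgebra ℂ (𝔻 → ℂ) where
  carrier := {f | IsNevanlinna f}
  mul_mem' hf hg := hf.mul hg
  add_mem' hf hg := hf.add hg
  algebraMap_mem' c := IsNevanlinna.const c

/-! ### Blaschke products and the two zero sequences -/

/-- The Blaschke product, as a function on the disc, with zeros `a k ≠ 0` in the disc
(repeated according to multiplicity). -/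
def blaschkeProduct (a : ℕ → ℂ) (z : 𝔻) : ℂ :=
  ∏' k, conj (a k) / (‖a k‖ : ℂ) * ((a k - z) / (1 - z * conj (a k)))

/-- The pseudohyperbolic distance. -/
def pseudohypDist (w z : 𝔻) : ℝ :=
  ‖((w : ℂ) - z) / (1 - (z : ℂ) * conj (w : ℂ))‖

/-- The real number `1 - 2⁻ᵏ` as a point of the disc. -/
def dyadicPoint (k : ℕ) : 𝔻 :=
  Complex.UnitDisc.mk (((1 - (2 : ℝ)⁻¹ ^ k : ℝ)) : ℂ) (by
    have h1 : (2 : ℝ)⁻¹ ^ k ≤ 1 := pow_le_one₀ (by norm_num) (by norm_num)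
    have h2 : (0 : ℝ) < (2 : ℝ)⁻¹ ^ k := by positivity
    rw [Complex.norm_real, Real.norm_eq_abs, abs_lt]
    constructor <;> linarith)

/-- The Blaschke product with zeros indexed by `k = 1, 2, 3, …`; the value at `k = 0` of the
sequence is ignored. -/
def blaschkeFromOne (a : ℕ → 𝔻) : 𝔻 → ℂ :=
  blaschkeProduct fun j => (a (j + 1) : ℂ)

/-- The sequence `(μ k)`, `k ≥ 1`, lies in `(0, 1)`, is asymptotically close to
`z k = 1 - 2⁻ᵏ`, and `|B₁ (μ k)|` is `exp (-1 / (1 - |z k|²))` for even `k` and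
`exp (-2 / (1 - |z k|²))` for odd `k`, where `B₁` is the Blaschke product with zeros `z k`,
`k ≥ 1`. -/
def IsNearbySequence (μ : ℕ → 𝔻) : Prop :=
  (∀ k, 1 ≤ k → ∃ t : ℝ, 0 < t ∧ t < 1 ∧ (μ k : ℂ) = t) ∧
  Tendsto (fun k => pseudohypDist (μ k) (dyadicPoint k)) atTop (𝓝 0) ∧
  ∀ k, 1 ≤ k → ‖blaschkeFromOne dyadicPoint (μ k)‖ =
    if Even k then Real.exp (-1 / (1 - ‖(dyadicPoint k : ℂ)‖ ^ 2))
    else Real.exp (-2 / (1 - ‖(dyadicPoint k : ℂ)‖ ^ 2))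

end

/-!
The pair of Blaschke products `B₁` (zeros `z k = 1 - 2⁻ᵏ`) and `B₂` (zeros `μ k`, very close to the
`z k`) is unimodular but not reducible in the Nevanlinna class.

*Irreducibility.* If `u` is a zero-free Nevanlinna function, then `log |u|` is the difference of two
positive harmonic functions. By Harnack's inequality a positive harmonic function `h` has the
property that `h r * (1 - r) / (1 + r)` decreases on `[0, 1)`, so `log |u r| * (1 - r) / (1 + r)`
has a limit as `r → 1` (`exists_tendsto_mul_of_harmonic_pos`,
`IsNevanlinna.exists_tendsto_log_norm`). This replaces the Herglotz representation by a measure on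
the circle, the limit being a multiple of the mass of that measure at `1`. If `u = B₁ + φ B₂` is
invertible, then `u (μ k) = B₁ (μ k)`, and the prescribed moduli make this limit `-1/4` along even
indices and `-1/2` along odd ones (`IsNearbySequence.exists_tendsto_quarter`).

*Unimodularity.* Since `|B₁|` is bounded by the pseudohyperbolic distance to each of its zeros, the
lower bound on `|B₁ (μ j)|` separates `μ j` from every `z k`, and this yields
`|B₂ (z k)| ≥ exp (-K 2ᵏ)` (`IsNearbySequence.exists_exp_le_norm`). With
`E = exp (s (1 + z) / (1 - z))` and `s` large, the values `1 / (E B₂)` at `z k` decay so fast that a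
Lagrange series interpolates them by a bounded holomorphic function `g`
(`exists_bounded_interpolation`). Then `1 / E - g B₂` is bounded and vanishes on the zeros of `B₁`,
so by the Schwarz lemma it is `q B₁` with `q` bounded and holomorphic
(`IsBlaschkeSeq.norm_le_mul_norm`, `exists_eq_mul_of_norm_le_mul_norm`), and
`E q B₁ + E g B₂ = 1`. The factor `E` lies in the Nevanlinna class because `log |E|` is a multiple
of the Poisson kernel.

*Existence of the points.* A crude lower bound for `B₁` at distance `4⁻ᵏ` from `z k` already exceeds
the prescribed modulus for large `k`, so the intermediate value theorem applies on a short interval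
ending at `z k`; for small `k` the interval `[0, z k]` is used (`exists_norm_blaschkeFun_eq`).
-/

open Metric Set

/-! ### Disc automorphisms and the Schwarz lemma -/

/-- The involutive automorphism of the unit disc that exchanges `a` and `0`. -/
noncomputable def diskAut (a z : ℂ) : ℂ := (a - z) / (1 - z * conj a)

theorem norm_one_sub_mul_conj_sq_sub (a z : ℂ) :
    ‖1 - z * conj a‖ ^ 2 - ‖a - z‖ ^ 2 = (1 - ‖a‖ ^ 2) * (1 - ‖z‖ ^ 2) := by
  simp only [← Complex.normSq_eq_norm_sq, Complex.normSq_apply, Complex.sub_re, Complex.sub_im,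
    Complex.mul_re, Complex.mul_im, Complex.conj_re, Complex.conj_im, Complex.one_re,
    Complex.one_im]
  ring

theorem one_sub_mul_conj_ne_zero {a z : ℂ} (ha : ‖a‖ < 1) (hz : ‖z‖ < 1) :
    1 - z * conj a ≠ 0 := by
  intro h
  have h1 : ‖z * conj a‖ = 1 := by rw [← sub_eq_zero.1 h, norm_one]
  rw [norm_mul, RCLike.norm_conj] at h1
  nlinarith [norm_nonneg a, norm_nonneg z]

theorem norm_diskAut_lt_one {a z : ℂ} (ha : ‖a‖ < 1) (hz : ‖z‖ < 1) : ‖diskAut a z‖ < 1 := by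
  have h0 := norm_pos_iff.2 (one_sub_mul_conj_ne_zero ha hz)
  rw [diskAut, norm_div, div_lt_one h0]
  refine lt_of_pow_lt_pow_left₀ 2 h0.le ?_
  have := norm_one_sub_mul_conj_sq_sub a z
  have h1 : 0 < (1 - ‖a‖ ^ 2) * (1 - ‖z‖ ^ 2) := by
    apply mul_pos <;> nlinarith [norm_nonneg a, norm_nonneg z]
  linarith

@[simp] theorem diskAut_self (a : ℂ) : diskAut a a = 0 := by simp [diskAut]

@[simp] theorem diskAut_zero_right (a : ℂ) : diskAut a 0 = a := by simp [diskAut]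

theorem diskAut_eq_zero_iff {a z : ℂ} (ha : ‖a‖ < 1) (hz : ‖z‖ < 1) :
    diskAut a z = 0 ↔ a = z := by
  rw [diskAut, div_eq_zero_iff, or_iff_left (one_sub_mul_conj_ne_zero ha hz), sub_eq_zero]

theorem diskAut_diskAut {a z : ℂ} (ha : ‖a‖ < 1) (hz : ‖z‖ < 1) :
    diskAut a (diskAut a z) = z := by
  have h1 := one_sub_mul_conj_ne_zero ha hz
  have h2 := one_sub_mul_conj_ne_zero ha ha
  have h3 := one_sub_mul_conj_ne_zero ha (norm_diskAut_lt_one ha hz)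
  rw [diskAut, div_eq_iff h3, diskAut]
  field_simp
  ring

theorem differentiableOn_diskAut {a : ℂ} (ha : ‖a‖ < 1) :
    DifferentiableOn ℂ (diskAut a) (ball 0 1) := by
  refine DifferentiableOn.div (by fun_prop) (by fun_prop) fun z hz => ?_
  exact one_sub_mul_conj_ne_zero ha (by simpa using hz)

theorem mapsTo_diskAut {a : ℂ} (ha : ‖a‖ < 1) : MapsTo (diskAut a) (ball 0 1) (ball 0 1) :=
  fun z hz => by simpa using norm_diskAut_lt_one ha (by simpa using hz)

/-- The Schwarz lemma for a function vanishing at a point other than the centre. -/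
theorem norm_le_mul_norm_diskAut {Q : ℂ → ℂ} {M : ℝ} {a z : ℂ}
    (hQ : DifferentiableOn ℂ Q (ball 0 1)) (hM : ∀ z ∈ ball (0 : ℂ) 1, ‖Q z‖ ≤ M)
    (ha : ‖a‖ < 1) (hQa : Q a = 0) (hz : ‖z‖ < 1) : ‖Q z‖ ≤ M * ‖diskAut a z‖ := by
  have h := Complex.dist_le_div_mul_dist_of_mapsTo_ball (f := Q ∘ diskAut a) (c := 0) (R₁ := 1)
    (R₂ := M) (z := diskAut a z) (hQ.comp (differentiableOn_diskAut ha) (mapsTo_diskAut ha))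
    (fun w hw => by simpa [hQa] using hM _ (mapsTo_diskAut ha hw))
    (by simpa using norm_diskAut_lt_one ha hz)
  simpa [hQa, diskAut_diskAut ha hz] using h

/-! ### Division of bounded holomorphic functions -/

/-- A holomorphic function dominated by a holomorphic function `B` is divisible by `B`: the
quotient has only removable singularities. -/
theorem exists_eq_mul_of_norm_le_mul_norm {U : Set ℂ} (hU : IsOpen U) (hUc : IsPreconnected U)
    {Q B : ℂ → ℂ} {M : ℝ} (hQ : DifferentiableOn ℂ Q U) (hB : DifferentiableOn ℂ B U)
    (hB0 : ∃ z ∈ U, B z ≠ 0) (h : ∀ z ∈ U, ‖Q z‖ ≤ M * ‖B z‖) :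
    ∃ q : ℂ → ℂ, DifferentiableOn ℂ q U ∧ (∀ z ∈ U, ‖q z‖ ≤ M) ∧ ∀ z ∈ U, Q z = q z * B z := by
  obtain ⟨z₀, hz₀, hBz₀⟩ := hB0
  have hne : ∀ p ∈ U, ∀ᶠ z in 𝓝[≠] p, z ∈ U ∧ B z ≠ 0 := by
    intro p hp
    have hU' : ∀ᶠ z in 𝓝[≠] p, z ∈ U := nhdsWithin_le_nhds (hU.mem_nhds hp)
    refine hU'.and ?_
    refine ((hB.analyticAt (hU.mem_nhds hp)).eventually_eq_zero_or_eventually_ne_zero).resolve_left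
      fun h0 => hBz₀ ?_
    exact (hB.analyticOnNhd hU).eqOn_zero_of_preconnected_of_eventuallyEq_zero hUc hp h0 hz₀
  set f : ℂ → ℂ := fun z => Q z / B z with hf
  have hfb : ∀ z ∈ U, B z ≠ 0 → ‖f z‖ ≤ M := fun z hz hBz => by
    rw [hf]; simp only
    rw [norm_div, div_le_iff₀ (norm_pos_iff.2 hBz)]; exact h z hz
  have hfd : ∀ z ∈ U, B z ≠ 0 → DifferentiableAt ℂ f z := fun z hz hBz =>
    (hQ.differentiableAt (hU.mem_nhds hz)).div (hB.differentiableAt (hU.mem_nhds hz)) hBz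
  set q : ℂ → ℂ := fun p => limUnder (𝓝[≠] p) f with hq
  have hqf : ∀ z ∈ U, B z ≠ 0 → q z = f z := fun z hz hBz =>
    ((hfd z hz hBz).continuousAt.tendsto.mono_left nhdsWithin_le_nhds).limUnder_eq
  have hqd : ∀ p ∈ U, DifferentiableAt ℂ q p := by
    intro p hp
    obtain ⟨V, hV, hVs⟩ := mem_nhdsWithin_iff_exists_mem_nhds_inter.1 (hne p hp)
    have hVs' : ∀ z ∈ V, z ≠ p → z ∈ U ∧ B z ≠ 0 := fun z hz hzp => hVs ⟨hz, hzp⟩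
    have hd := Complex.differentiableOn_update_limUnder_of_bddAbove hV (f := f)
      (fun z hz => (hfd z (hVs' z hz.1 hz.2).1 (hVs' z hz.1 hz.2).2).differentiableWithinAt)
      ⟨M, by
        rintro _ ⟨z, hz, rfl⟩
        exact hfb z (hVs' z hz.1 hz.2).1 (hVs' z hz.1 hz.2).2⟩
    refine (hd.differentiableAt hV).congr_of_eventuallyEq ?_
    filter_upwards [hV] with z hz
    rcases eq_or_ne z p with rfl | hzp
    · simp [hq]
    · rw [Function.update_of_ne hzp, hqf z (hVs' z hz hzp).1 (hVs' z hz hzp).2]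
  refine ⟨q, fun p hp => (hqd p hp).differentiableWithinAt, fun p hp => ?_, fun p hp => ?_⟩
  · have ht : Tendsto (fun z => ‖q z‖) (𝓝[≠] p) (𝓝 ‖q p‖) :=
      (hqd p hp).continuousAt.norm.tendsto.mono_left nhdsWithin_le_nhds
    refine le_of_tendsto ht ?_
    filter_upwards [hne p hp] with z hz
    rw [hqf z hz.1 hz.2]
    exact hfb z hz.1 hz.2
  · by_cases hBp : B p = 0
    · have := h p hp
      rw [hBp, norm_zero, mul_zero] at this
      rw [norm_le_zero_iff.1 this, hBp, mul_zero]
    · rw [hqf p hp hBp, hf]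
      exact (div_mul_cancel₀ _ hBp).symm

/-- A bounded holomorphic function is dominated by any finite Blaschke product with simple zeros
that are zeros of the function. -/
theorem norm_le_mul_prod_norm_diskAut {ι : Type*} (s : Finset ι) {a : ι → ℂ}
    (ha : ∀ j ∈ s, ‖a j‖ < 1) (hinj : Set.InjOn a s) {Q : ℂ → ℂ} {M : ℝ}
    (hQ : DifferentiableOn ℂ Q (ball 0 1)) (hM : ∀ z ∈ ball (0 : ℂ) 1, ‖Q z‖ ≤ M)
    (hQa : ∀ j ∈ s, Q (a j) = 0) {z : ℂ} (hz : ‖z‖ < 1) :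
    ‖Q z‖ ≤ M * ∏ j ∈ s, ‖diskAut (a j) z‖ := by
  classical
  induction s using Finset.induction_on generalizing Q with
  | empty => simpa using hM z (by simpa using hz)
  | insert i s his ih =>
    have hi := ha i (s.mem_insert_self i)
    obtain ⟨q, hqd, hqM, hqQ⟩ := exists_eq_mul_of_norm_le_mul_norm isOpen_ball
      (convex_ball (0 : ℂ) 1).isPreconnected hQ (differentiableOn_diskAut hi)
      (by
        obtain ⟨w, hw, hwi⟩ : ∃ w ∈ ball (0 : ℂ) 1, w ≠ a i := by
          rcases eq_or_ne (a i) 0 with h0 | h0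
          · exact ⟨1 / 2, by norm_num, by norm_num [h0]⟩
          · exact ⟨0, by simp, h0.symm⟩
        exact ⟨w, hw, fun h0 => hwi ((diskAut_eq_zero_iff hi (by simpa using hw)).1 h0).symm⟩)
      (fun w hw => norm_le_mul_norm_diskAut hQ hM hi (hQa i (s.mem_insert_self i))
        (by simpa using hw))
    have hq0 : ∀ j ∈ s, q (a j) = 0 := by
      intro j hj
      have hj' := Finset.mem_insert_of_mem (b := i) hj
      have hjb : a j ∈ ball (0 : ℂ) 1 := by simpa using ha j hj'
      have h0 := hqQ _ hjb
      rw [hQa j hj', eq_comm, mul_eq_zero] at h0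
      refine h0.resolve_right fun h1 => his ?_
      have := hinj (s.mem_insert_self i) hj' ((diskAut_eq_zero_iff hi (ha j hj')).1 h1)
      rwa [this]
    have := ih (fun j hj => ha j (Finset.mem_insert_of_mem hj))
      (hinj.mono (by simp)) hqd hqM hq0
    rw [hqQ z (by simpa using hz), norm_mul, Finset.prod_insert his]
    calc ‖q z‖ * ‖diskAut (a i) z‖ ≤ (M * ∏ j ∈ s, ‖diskAut (a j) z‖) * ‖diskAut (a i) z‖ := by
          gcongr
      _ = _ := by ring

/-! ### Radial growth of positive harmonic functions -/

theorem norm_diskAut_ofReal {r s : ℝ} (hr : 0 ≤ r) (hrs : r ≤ s) (hs : s < 1) :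
    ‖diskAut r s‖ = (s - r) / (1 - s * r) := by
  have h : diskAut r s = ((-((s - r) / (1 - s * r)) : ℝ) : ℂ) := by
    rw [diskAut, Complex.conj_ofReal]; push_cast; ring
  rw [h, Complex.norm_real, norm_neg, Real.norm_of_nonneg]
  exact div_nonneg (by linarith) (by nlinarith)

/-- Harnack's inequality along a radius, for a holomorphic function with positive real part. -/
theorem re_mul_le_re_mul_of_re_pos {F : ℂ → ℂ} (hF : DifferentiableOn ℂ F (ball 0 1))
    (hpos : ∀ z ∈ ball (0 : ℂ) 1, 0 < (F z).re) {r s : ℝ} (hr : 0 ≤ r) (hrs : r ≤ s) (hs : s < 1) :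
    (F s).re * ((1 - s) / (1 + s)) ≤ (F r).re * ((1 - r) / (1 + r)) := by
  have hrn : ‖(r : ℂ)‖ < 1 := by rw [Complex.norm_real, Real.norm_of_nonneg hr]; linarith
  have hsn : ‖(s : ℂ)‖ < 1 := by
    rw [Complex.norm_real, Real.norm_of_nonneg (hr.trans hrs)]; exact hs
  have hrb : (r : ℂ) ∈ ball (0 : ℂ) 1 := by simpa using hrn
  have hsb : (s : ℂ) ∈ ball (0 : ℂ) 1 := by simpa using hsn
  set A := F r with hA
  have hApos := hpos _ hrb
  have hden : ∀ z ∈ ball (0 : ℂ) 1, F z + conj A ≠ 0 := fun z hz h0 => by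
    have := congrArg Complex.re h0
    simp only [Complex.add_re, Complex.conj_re, Complex.zero_re] at this
    linarith [hpos z hz]
  -- The Cayley transform centred at `A` maps the right half-plane to the disc and `A` to `0`.
  have hG := norm_le_mul_norm_diskAut (Q := fun z => (F z - A) / (F z + conj A)) (M := 1)
    (a := r) (z := s) ((hF.sub_const _).div (hF.add_const _) hden)
    (fun z hz => by
      rw [norm_div, div_le_one (norm_pos_iff.2 (hden z hz))]
      refine le_of_sq_le_sq ?_ (norm_nonneg _)
      rw [← Complex.normSq_eq_norm_sq, ← Complex.normSq_eq_norm_sq, Complex.normSq_apply,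
        Complex.normSq_apply]
      simp only [Complex.add_re, Complex.conj_re, Complex.add_im, Complex.conj_im,
        Complex.sub_re, Complex.sub_im]
      nlinarith [mul_pos (hpos z hz) hApos]) hrn (by simp [hA]) hsn
  rw [norm_diskAut_ofReal hr hrs hs, one_mul, norm_div,
    div_le_iff₀ (norm_pos_iff.2 (hden _ hsb))] at hG
  have hD : 0 < 1 - s * r := by nlinarith
  set ρ := (s - r) / (1 - s * r) with hρ
  have hρ0 : 0 ≤ ρ := div_nonneg (by linarith) hD.le
  have hρ1 : ρ < 1 := by rw [hρ, div_lt_one hD]; nlinarith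
  have hsq := pow_le_pow_left₀ (norm_nonneg _) hG 2
  rw [mul_pow, ← Complex.normSq_eq_norm_sq, ← Complex.normSq_eq_norm_sq, Complex.normSq_apply,
    Complex.normSq_apply] at hsq
  simp only [Complex.add_re, Complex.conj_re, Complex.add_im, Complex.conj_im,
    Complex.sub_re, Complex.sub_im] at hsq
  have hx := hpos _ hsb
  set x := (F s).re
  set a := A.re
  have h1 : (x - a) ^ 2 ≤ (ρ * (x + a)) ^ 2 := by
    have hρ2 : ρ ^ 2 ≤ 1 := by nlinarith
    nlinarith [mul_nonneg (sub_nonneg.2 hρ2) (sq_nonneg ((F s).im - A.im))]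
  have h2 : x - a ≤ ρ * (x + a) :=
    (le_abs_self _).trans (abs_le_of_sq_le_sq h1 (by positivity))
  have h3 : x * (1 - ρ) ≤ a * (1 + ρ) := by linarith
  have e1 : 1 - ρ = (1 - s) * (1 + r) / (1 - s * r) := by rw [hρ]; field_simp; ring
  have e2 : 1 + ρ = (1 - r) * (1 + s) / (1 - s * r) := by rw [hρ]; field_simp; ring
  rw [e1, e2, ← mul_div_assoc, ← mul_div_assoc, div_le_div_iff_of_pos_right hD] at h3
  rw [← mul_div_assoc, ← mul_div_assoc, div_le_div_iff₀ (by linarith) (by linarith)]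
  linarith

/-- A positive harmonic function on the unit disc, multiplied by the reciprocal of the Poisson
kernel of the boundary point `1`, has a radial limit at `1`: by Harnack's inequality this product
decreases along the radius. -/
theorem exists_tendsto_mul_of_harmonic_pos {h : ℂ → ℝ} (hh : HarmonicOnNhd h (ball 0 1))
    (hpos : ∀ z ∈ ball (0 : ℂ) 1, 0 < h z) :
    ∃ L : ℝ, Tendsto (fun r : ℝ => h r * ((1 - r) / (1 + r))) (𝓝[<] 1) (𝓝 L) := by
  obtain ⟨F, hF, hFh⟩ := hh.exists_analyticOnNhd_ball_re_eq
  have hmem : ∀ t : ℝ, 0 ≤ t → t < 1 → (t : ℂ) ∈ ball (0 : ℂ) 1 := fun t h0 h1 => by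
    rw [mem_ball_zero_iff, Complex.norm_real, Real.norm_of_nonneg h0]; exact h1
  have hFre : ∀ z ∈ ball (0 : ℂ) 1, (F z).re = h z := fun z hz => hFh hz
  set g : ℝ → ℝ := fun r => h r * ((1 - r) / (1 + r)) with hg
  have hanti : ∀ r s : ℝ, 0 ≤ r → r ≤ s → s < 1 → g s ≤ g r := by
    intro r s hr hrs hs
    have := re_mul_le_re_mul_of_re_pos hF.differentiableOn
      (fun z hz => by rw [hFre z hz]; exact hpos z hz) hr hrs hs
    rwa [hFre _ (hmem s (hr.trans hrs) hs), hFre _ (hmem r hr (hrs.trans_lt hs))] at this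
  have hnn : ∀ r : ℝ, 0 ≤ r → r < 1 → 0 ≤ g r := fun r hr hr1 =>
    mul_nonneg (hpos _ (hmem r hr hr1)).le (div_nonneg (by linarith) (by linarith))
  refine ⟨sInf (g '' Ico 0 1), ?_⟩
  have hbdd : BddBelow (g '' Ico 0 1) := ⟨0, by rintro _ ⟨r, hr, rfl⟩; exact hnn r hr.1 hr.2⟩
  rw [tendsto_order]
  constructor
  · intro c hc
    filter_upwards [Ico_mem_nhdsLT (zero_lt_one' ℝ)] with r hr
    exact hc.trans_le (csInf_le hbdd ⟨r, hr, rfl⟩)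
  · intro c hc
    obtain ⟨_, ⟨r, hr, rfl⟩, hrc⟩ :=
      exists_lt_of_csInf_lt ((nonempty_Ico.2 (zero_lt_one' ℝ)).image g) hc
    filter_upwards [Ico_mem_nhdsLT hr.2] with s hs
    exact (hanti r s hr.1 hs.1 hs.2).trans_lt hrc

/-! ### Blaschke products -/

/-- The Blaschke product with zeros `a k`, as a function on the plane; only its values on the unit
disc matter. -/
noncomputable def blaschkeFun (a : ℕ → ℂ) (z : ℂ) : ℂ :=
  ∏' k, conj (a k) / (‖a k‖ : ℂ) * diskAut (a k) z

/-- The sequence `a` consists of nonzero points of the unit disc and satisfies the Blaschke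
condition. -/
structure IsBlaschkeSeq (a : ℕ → ℂ) : Prop where
  ne_zero : ∀ k, a k ≠ 0
  norm_lt_one : ∀ k, ‖a k‖ < 1
  summable : Summable fun k => 1 - ‖a k‖

theorem norm_conj_div_norm_mul {a : ℂ} (ha : a ≠ 0) (w : ℂ) :
    ‖conj a / (‖a‖ : ℂ) * w‖ = ‖w‖ := by
  rw [norm_mul, norm_div, RCLike.norm_conj, Complex.norm_real, norm_norm,
    div_self (norm_ne_zero_iff.2 ha), one_mul]

theorem norm_blaschkeFactor_sub_one_le {a z : ℂ} (ha0 : a ≠ 0) (ha : ‖a‖ < 1) (hz : ‖z‖ < 1) :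
    ‖conj a / (‖a‖ : ℂ) * diskAut a z - 1‖ ≤ (1 - ‖a‖) * (2 / (1 - ‖z‖)) := by
  have hn : (‖a‖ : ℂ) ≠ 0 := by simpa using ha0
  have hD := one_sub_mul_conj_ne_zero ha hz
  have key : conj a / (‖a‖ : ℂ) * diskAut a z - 1 =
      -((1 - ‖a‖ : ℝ) * (1 + conj a / (‖a‖ : ℂ) * z)) / (1 - z * conj a) := by
    have h2 : conj a * a = (‖a‖ : ℂ) ^ 2 := Complex.conj_mul' a
    rw [diskAut, eq_div_iff hD, sub_mul, mul_assoc, div_mul_cancel₀ _ hD]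
    push_cast
    field_simp
    linear_combination h2
  have h1 : ‖1 + conj a / (‖a‖ : ℂ) * z‖ ≤ 2 := by
    refine (norm_add_le _ _).trans ?_
    rw [norm_conj_div_norm_mul ha0, norm_one]; linarith
  have h2 : 1 - ‖z‖ ≤ ‖1 - z * conj a‖ := by
    have := norm_sub_norm_le (1 : ℂ) (z * conj a)
    rw [norm_one, norm_mul, RCLike.norm_conj] at this
    nlinarith [norm_nonneg z, norm_nonneg a]
  rw [key, norm_div, norm_neg, norm_mul, Complex.norm_real, Real.norm_of_nonneg (by linarith),
    mul_div_assoc]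
  gcongr

theorem differentiableOn_blaschkeFactor {a : ℂ} (ha : ‖a‖ < 1) :
    DifferentiableOn ℂ (fun z => conj a / (‖a‖ : ℂ) * diskAut a z) (ball 0 1) :=
  (differentiableOn_diskAut ha).const_mul _

variable {a : ℕ → ℂ}

theorem IsBlaschkeSeq.hasProdLocallyUniformlyOn (ha : IsBlaschkeSeq a) {r : ℝ} (hr : r < 1) :
    HasProdLocallyUniformlyOn (fun k z => conj (a k) / (‖a k‖ : ℂ) * diskAut (a k) z)
      (blaschkeFun a) (ball 0 r) := by
  have hsub : ball (0 : ℂ) r ⊆ ball 0 1 := ball_subset_ball hr.le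
  have := Summable.hasProdLocallyUniformlyOn_nat_one_add (K := ball (0 : ℂ) r)
    (f := fun k z => conj (a k) / (‖a k‖ : ℂ) * diskAut (a k) z - 1) isOpen_ball
    (ha.summable.mul_right (2 / (1 - r)))
    (Eventually.of_forall fun k z hz => by
      have hz' : ‖z‖ < r := by simpa using hz
      refine (norm_blaschkeFactor_sub_one_le (ha.ne_zero k) (ha.norm_lt_one k)
        (hz'.trans hr)).trans ?_
      have := ha.norm_lt_one k
      gcongr)
    (fun k => (((differentiableOn_blaschkeFactor (ha.norm_lt_one k)).mono hsub).sub_const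
      1).continuousOn)
  simp only [add_sub_cancel] at this
  exact this

theorem IsBlaschkeSeq.hasProd (ha : IsBlaschkeSeq a) {z : ℂ} (hz : ‖z‖ < 1) :
    HasProd (fun k => conj (a k) / (‖a k‖ : ℂ) * diskAut (a k) z) (blaschkeFun a z) := by
  obtain ⟨r, hzr, hr⟩ := exists_between hz
  exact (ha.hasProdLocallyUniformlyOn hr).hasProd (by simpa using hzr)

theorem IsBlaschkeSeq.hasProd_norm (ha : IsBlaschkeSeq a) {z : ℂ} (hz : ‖z‖ < 1) :
    HasProd (fun k => ‖diskAut (a k) z‖) ‖blaschkeFun a z‖ := by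
  have := (ha.hasProd hz).norm
  simpa only [norm_conj_div_norm_mul (ha.ne_zero _)] using this

theorem IsBlaschkeSeq.differentiableOn (ha : IsBlaschkeSeq a) :
    DifferentiableOn ℂ (blaschkeFun a) (ball 0 1) := by
  intro z hz
  obtain ⟨r, hzr, hr⟩ := exists_between (mem_ball_zero_iff.1 hz)
  have hd : DifferentiableOn ℂ (blaschkeFun a) (ball 0 r) := by
    refine TendstoLocallyUniformlyOn.differentiableOn
      (hasProdLocallyUniformlyOn_iff_tendstoLocallyUniformlyOn.1
        (ha.hasProdLocallyUniformlyOn hr)) (Eventually.of_forall fun s => ?_) isOpen_ball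
    refine DifferentiableOn.fun_finsetProd fun k _ => ?_
    exact (differentiableOn_blaschkeFactor (ha.norm_lt_one k)).mono (ball_subset_ball hr.le)
  exact (hd.differentiableAt (isOpen_ball.mem_nhds (by simpa using hzr))).differentiableWithinAt

theorem IsBlaschkeSeq.norm_le_diskAut (ha : IsBlaschkeSeq a) {z : ℂ} (hz : ‖z‖ < 1) (j : ℕ) :
    ‖blaschkeFun a z‖ ≤ ‖diskAut (a j) z‖ := by
  refine le_of_tendsto (ha.hasProd_norm hz) ?_
  filter_upwards [eventually_ge_atTop {j}] with s hs
  have hj : j ∈ s := by simpa using hs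
  rw [← Finset.mul_prod_erase s _ hj]
  refine mul_le_of_le_one_right (norm_nonneg _) (Finset.prod_le_one (fun _ _ => norm_nonneg _)
    fun k _ => (norm_diskAut_lt_one (ha.norm_lt_one k) hz).le)

theorem IsBlaschkeSeq.norm_le_one (ha : IsBlaschkeSeq a) {z : ℂ} (hz : ‖z‖ < 1) :
    ‖blaschkeFun a z‖ ≤ 1 :=
  (ha.norm_le_diskAut hz 0).trans (norm_diskAut_lt_one (ha.norm_lt_one 0) hz).le

theorem IsBlaschkeSeq.apply_eq_zero (ha : IsBlaschkeSeq a) (j : ℕ) : blaschkeFun a (a j) = 0 := by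
  simpa using ha.norm_le_diskAut (ha.norm_lt_one j) j

/-- A bounded holomorphic function vanishing on an injective Blaschke sequence is dominated by
the Blaschke product. -/
theorem IsBlaschkeSeq.norm_le_mul_norm (ha : IsBlaschkeSeq a) (hinj : Function.Injective a)
    {Q : ℂ → ℂ} {M : ℝ} (hQ : DifferentiableOn ℂ Q (ball 0 1))
    (hM : ∀ z ∈ ball (0 : ℂ) 1, ‖Q z‖ ≤ M) (hQa : ∀ j, Q (a j) = 0) {z : ℂ} (hz : ‖z‖ < 1) :
    ‖Q z‖ ≤ M * ‖blaschkeFun a z‖ :=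
  ge_of_tendsto ((ha.hasProd_norm hz).const_mul M) <| Eventually.of_forall fun s =>
    norm_le_mul_prod_norm_diskAut s (fun j _ => ha.norm_lt_one j) hinj.injOn hQ hM
      (fun j _ => hQa j) hz

theorem one_sub_sum_le_prod {ι : Type*} (s : Finset ι) {x : ι → ℝ} (h0 : ∀ i ∈ s, 0 ≤ x i)
    (h1 : ∀ i ∈ s, x i ≤ 1) : 1 - ∑ i ∈ s, (1 - x i) ≤ ∏ i ∈ s, x i := by
  classical
  induction s using Finset.induction_on with
  | empty => simp
  | insert i s hi ih =>
    have hs := ih (fun j hj => h0 j (Finset.mem_insert_of_mem hj))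
      fun j hj => h1 j (Finset.mem_insert_of_mem hj)
    have hp : ∏ j ∈ s, x j ≤ 1 := Finset.prod_le_one
      (fun j hj => h0 j (Finset.mem_insert_of_mem hj))
      fun j hj => h1 j (Finset.mem_insert_of_mem hj)
    rw [Finset.sum_insert hi, Finset.prod_insert hi]
    nlinarith [h0 i (s.mem_insert_self i), h1 i (s.mem_insert_self i)]

theorem isBlaschkeSeq_of_le_geometric {C : ℝ} (h0 : ∀ k, a k ≠ 0) (h1 : ∀ k, ‖a k‖ < 1)
    (hC : ∀ k, 1 - ‖a k‖ ≤ C * (1 / 2) ^ k) : IsBlaschkeSeq a where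
  ne_zero := h0
  norm_lt_one := h1
  summable := Summable.of_nonneg_of_le (fun k => by linarith [h1 k]) hC
    (summable_geometric_two.mul_left C)

/-- A lower bound for a Blaschke product whose zeros approach the circle geometrically: the
factors from the index `N` on contribute at least `1 / 2`. -/
theorem IsBlaschkeSeq.prod_mul_half_le_norm (ha : IsBlaschkeSeq a) {C : ℝ}
    (hC : ∀ k, 1 - ‖a k‖ ≤ C * (1 / 2) ^ k) {z : ℂ} (hz : ‖z‖ < 1) {N : ℕ}
    (hN : 8 * C * (1 / 2) ^ N ≤ 1 - ‖z‖) {d : ℕ → ℝ} (hd0 : ∀ j < N, 0 ≤ d j)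
    (hd : ∀ j < N, d j ≤ ‖diskAut (a j) z‖) :
    (∏ j ∈ Finset.range N, d j) * (1 / 2) ≤ ‖blaschkeFun a z‖ := by
  refine ge_of_tendsto (ha.hasProd_norm hz).tendsto_prod_nat ?_
  filter_upwards [eventually_ge_atTop N] with n hn
  obtain ⟨m, rfl⟩ := Nat.exists_eq_add_of_le hn
  rw [Finset.prod_range_add]
  have hz' : 0 < 1 - ‖z‖ := by linarith
  have hC0 : 0 ≤ C := by have := hC 0; have := ha.norm_lt_one 0; simp at *; linarith
  have hterm : ∀ j, 1 - ‖diskAut (a (N + j)) z‖ ≤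
      C * (1 / 2) ^ N * (2 / (1 - ‖z‖)) * (1 / 2) ^ j := by
    intro j
    have h1 := norm_blaschkeFactor_sub_one_le (ha.ne_zero (N + j)) (ha.norm_lt_one (N + j)) hz
    have h2 := norm_sub_norm_le (1 : ℂ)
      (conj (a (N + j)) / (‖a (N + j)‖ : ℂ) * diskAut (a (N + j)) z)
    rw [norm_one, norm_conj_div_norm_mul (ha.ne_zero _), norm_sub_rev] at h2
    refine h2.trans (h1.trans ?_)
    calc _ ≤ C * (1 / 2) ^ (N + j) * (2 / (1 - ‖z‖)) := by gcongr; exact hC _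
      _ = _ := by rw [pow_add]; ring
  have hsum : ∑ j ∈ Finset.range m, (1 - ‖diskAut (a (N + j)) z‖) ≤ 1 / 2 := by
    calc _ ≤ ∑ j ∈ Finset.range m, C * (1 / 2) ^ N * (2 / (1 - ‖z‖)) * (1 / 2) ^ j :=
          Finset.sum_le_sum fun j _ => hterm j
      _ = C * (1 / 2) ^ N * (2 / (1 - ‖z‖)) * ∑ j ∈ Finset.range m, (1 / 2 : ℝ) ^ j := by
          rw [Finset.mul_sum]
      _ ≤ C * (1 / 2) ^ N * (2 / (1 - ‖z‖)) * 2 := by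
          gcongr
          exact sum_geometric_two_le m
      _ = 4 * C * (1 / 2) ^ N / (1 - ‖z‖) := by ring
      _ ≤ 1 / 2 := by rw [div_le_iff₀ hz']; linarith
  have htail : 1 / 2 ≤ ∏ j ∈ Finset.range m, ‖diskAut (a (N + j)) z‖ := by
    have := one_sub_sum_le_prod (Finset.range m) (x := fun j => ‖diskAut (a (N + j)) z‖)
      (fun j _ => norm_nonneg _) fun j _ => (norm_diskAut_lt_one (ha.norm_lt_one _) hz).le
    linarith
  refine mul_le_mul ?_ htail (by norm_num) (Finset.prod_nonneg fun _ _ => norm_nonneg _)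
  exact Finset.prod_le_prod (fun j hj => hd0 j (Finset.mem_range.1 hj))
    fun j hj => hd j (Finset.mem_range.1 hj)

/-! ### The dyadic Blaschke product and the nearby sequence -/

theorem coe_dyadicPoint (k : ℕ) : (dyadicPoint k : ℂ) = ((1 - (1 / 2) ^ k : ℝ) : ℂ) := by
  rw [dyadicPoint, Complex.UnitDisc.coe_mk]; norm_num

/-- The zeros `1 - 2⁻ᵏ`, `k ≥ 1`, indexed from `0`. -/
noncomputable def dyadicZero (j : ℕ) : ℂ := dyadicPoint (j + 1)

theorem dyadicZero_eq (j : ℕ) : dyadicZero j = ((1 - (1 / 2) ^ (j + 1) : ℝ) : ℂ) :=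
  coe_dyadicPoint (j + 1)

theorem half_pow_succ_le_half (j : ℕ) : (1 / 2 : ℝ) ^ (j + 1) ≤ 1 / 2 := by
  have : (1 / 2 : ℝ) ^ j ≤ 1 := pow_le_one₀ (by norm_num) (by norm_num)
  rw [pow_succ]; linarith

theorem norm_dyadicPoint (k : ℕ) : ‖(dyadicPoint k : ℂ)‖ = 1 - (1 / 2) ^ k := by
  rw [coe_dyadicPoint, Complex.norm_real, Real.norm_of_nonneg]
  have : (1 / 2 : ℝ) ^ k ≤ 1 := pow_le_one₀ (by norm_num) (by norm_num)
  linarith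

theorem norm_dyadicZero (j : ℕ) : ‖dyadicZero j‖ = 1 - (1 / 2) ^ (j + 1) := norm_dyadicPoint _

theorem one_sub_norm_dyadicZero (j : ℕ) : 1 - ‖dyadicZero j‖ ≤ 1 / 2 * (1 / 2) ^ j := by
  rw [norm_dyadicZero, pow_succ]; linarith

theorem norm_dyadicZero_lt_one (j : ℕ) : ‖dyadicZero j‖ < 1 :=
  (dyadicPoint (j + 1)).norm_lt_one

theorem dyadicZero_ne_zero (j : ℕ) : dyadicZero j ≠ 0 := by
  rw [← norm_ne_zero_iff, norm_dyadicZero]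
  linarith [half_pow_succ_le_half j]

theorem isBlaschkeSeq_dyadicZero : IsBlaschkeSeq dyadicZero :=
  isBlaschkeSeq_of_le_geometric dyadicZero_ne_zero norm_dyadicZero_lt_one one_sub_norm_dyadicZero

theorem dyadicZero_injective : Function.Injective dyadicZero := by
  intro i j h
  have h1 := congrArg norm h
  rw [norm_dyadicZero, norm_dyadicZero] at h1
  have h2 : (1 / 2 : ℝ) ^ (i + 1) = (1 / 2) ^ (j + 1) := by linarith
  have := pow_right_injective₀ (by norm_num : (0 : ℝ) < 1 / 2) (by norm_num) h2
  omega

theorem blaschkeFromOne_dyadicPoint (z : 𝔻) :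
    blaschkeFromOne dyadicPoint z = blaschkeFun dyadicZero z := rfl

/-- The prescribed value `|B₁ (μ k)|`. -/
noncomputable def targetModulus (k : ℕ) : ℝ :=
  if Even k then Real.exp (-1 / (1 - ‖(dyadicPoint k : ℂ)‖ ^ 2))
    else Real.exp (-2 / (1 - ‖(dyadicPoint k : ℂ)‖ ^ 2))

theorem one_sub_norm_dyadicPoint_sq (k : ℕ) :
    1 - ‖(dyadicPoint k : ℂ)‖ ^ 2 = (1 / 2) ^ k * (2 - (1 / 2) ^ k) := by
  rw [norm_dyadicPoint]; ring

theorem one_sub_norm_dyadicPoint_sq_pos (k : ℕ) : 0 < 1 - ‖(dyadicPoint k : ℂ)‖ ^ 2 := by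
  linarith [(dyadicPoint k).sq_norm_lt_one]

theorem targetModulus_pos (k : ℕ) : 0 < targetModulus k := by
  rw [targetModulus]; split_ifs <;> exact Real.exp_pos _

theorem targetModulus_le (k : ℕ) :
    targetModulus k ≤ Real.exp (-1 / (1 - ‖(dyadicPoint k : ℂ)‖ ^ 2)) := by
  rw [targetModulus]
  split_ifs
  · rfl
  · have := one_sub_norm_dyadicPoint_sq_pos k
    gcongr
    norm_num

theorem le_targetModulus (k : ℕ) : Real.exp (-(2 * 2 ^ k)) ≤ targetModulus k := by
  have h := one_sub_norm_dyadicPoint_sq_pos k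
  have h1 : Real.exp (-2 / (1 - ‖(dyadicPoint k : ℂ)‖ ^ 2)) ≤ targetModulus k := by
    rw [targetModulus]
    split_ifs
    · gcongr; norm_num
    · rfl
  refine le_trans (Real.exp_le_exp.2 ?_) h1
  rw [le_div_iff₀ h, one_sub_norm_dyadicPoint_sq]
  have h2 : (1 / 2 : ℝ) ^ k ≤ 1 := pow_le_one₀ (by norm_num) (by norm_num)
  have h3 : (2 : ℝ) ^ k * (1 / 2) ^ k = 1 := by rw [← mul_pow]; norm_num
  calc -(2 * (2 : ℝ) ^ k) * ((1 / 2) ^ k * (2 - (1 / 2) ^ k))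
      = -2 * ((2 : ℝ) ^ k * (1 / 2) ^ k) * (2 - (1 / 2) ^ k) := by ring
    _ ≤ -2 := by rw [h3]; linarith

theorem targetModulus_le_exp_two_pow (k : ℕ) : targetModulus k ≤ Real.exp (-(2 ^ k / 2)) := by
  refine (targetModulus_le k).trans (Real.exp_le_exp.2 ?_)
  rw [div_le_iff₀ (one_sub_norm_dyadicPoint_sq_pos k), one_sub_norm_dyadicPoint_sq]
  have h2 : 0 ≤ (1 / 2 : ℝ) ^ k := by positivity
  have h3 : (2 : ℝ) ^ k * (1 / 2) ^ k = 1 := by rw [← mul_pow]; norm_num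
  calc (-1 : ℝ) ≤ -(1 / 2) * ((2 : ℝ) ^ k * (1 / 2) ^ k) * (2 - (1 / 2) ^ k) := by
        rw [h3]; linarith
    _ = _ := by ring

theorem targetModulus_lt_norm_blaschkeFun_zero {k : ℕ} (hk : 1 ≤ k) :
    targetModulus k < ‖blaschkeFun dyadicZero 0‖ := by
  have h1 : targetModulus k ≤ Real.exp (-2) := by
    rcases eq_or_lt_of_le hk with rfl | hk2
    · rw [targetModulus, if_neg (by decide), norm_dyadicPoint]
      gcongr
      norm_num
    · refine (targetModulus_le_exp_two_pow k).trans (Real.exp_le_exp.2 ?_)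
      have : (2 : ℝ) ^ 2 ≤ 2 ^ k := pow_le_pow_right₀ (by norm_num) hk2
      linarith
  have h2 : Real.exp (-2) < 3 / 16 := by
    rw [Real.exp_neg, show (2 : ℝ) = 1 + 1 by norm_num, Real.exp_add,
      inv_lt_comm₀ (by positivity) (by norm_num)]
    nlinarith [Real.exp_one_gt_d9]
  have h3 := isBlaschkeSeq_dyadicZero.prod_mul_half_le_norm one_sub_norm_dyadicZero
    (z := 0) (by simp) (N := 2) (by norm_num)
    (d := fun j => 1 - (1 / 2) ^ (j + 1)) (fun j _ => by linarith [half_pow_succ_le_half j])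
    (fun j _ => by rw [diskAut_zero_right, norm_dyadicZero])
  norm_num [Finset.prod_range_succ] at h3
  linarith

theorem abs_sub_le_norm_diskAut_ofReal {a t : ℝ} (ha0 : 0 ≤ a) (ha1 : a < 1) (ht0 : 0 ≤ t)
    (ht1 : t < 1) : |a - t| ≤ ‖diskAut a t‖ := by
  have h : diskAut a t = (((a - t) / (1 - t * a) : ℝ) : ℂ) := by
    rw [diskAut, Complex.conj_ofReal]; push_cast; ring
  have hD : 0 < 1 - t * a := by nlinarith
  rw [h, Complex.norm_real, Real.norm_eq_abs, abs_div, abs_of_pos hD, le_div_iff₀ hD]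
  nlinarith [abs_nonneg (a - t), mul_nonneg ht0 ha0]

theorem continuousOn_norm_blaschkeFun_ofReal {a : ℕ → ℂ} (ha : IsBlaschkeSeq a) :
    ContinuousOn (fun t : ℝ => ‖blaschkeFun a t‖) (Ico 0 1) :=
  (ha.differentiableOn.continuousOn.comp Complex.continuous_ofReal.continuousOn fun t ht => by
    rw [mem_ball_zero_iff, Complex.norm_real, Real.norm_of_nonneg ht.1]; exact ht.2).norm

theorem four_mul_succ_sq_le_two_pow {k : ℕ} (hk : 10 ≤ k) : 4 * ((k : ℝ) + 1) ^ 2 ≤ 2 ^ k := by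
  induction k, hk using Nat.le_induction with
  | base => norm_num
  | succ k hk ih =>
    have : (10 : ℝ) ≤ k := by exact_mod_cast hk
    rw [pow_succ (2 : ℝ) k]; push_cast
    nlinarith

/-- At distance `4⁻ᵏ` from the zero `1 - 2⁻ᵏ` the dyadic Blaschke product is at least `4⁻ᵐ` with
`m` quadratic in `k`, hence much larger than the prescribed modulus. -/
theorem targetModulus_le_norm_blaschkeFun {k : ℕ} (hk : 10 ≤ k) :
    targetModulus k ≤ ‖blaschkeFun dyadicZero ((1 - (1 / 2) ^ k - (1 / 4) ^ k : ℝ) : ℂ)‖ := by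
  set t : ℝ := 1 - (1 / 2) ^ k - (1 / 4) ^ k with ht
  have e4 : (1 / 4 : ℝ) ^ k = (1 / 2) ^ k * (1 / 2) ^ k := by rw [← mul_pow]; norm_num
  have hx : (0 : ℝ) < (1 / 2) ^ k := by positivity
  have hx1 : (1 / 2 : ℝ) ^ k ≤ 1 / 2 := by
    obtain ⟨j, rfl⟩ : ∃ j, k = j + 1 := ⟨k - 1, by omega⟩
    exact half_pow_succ_le_half j
  have ht0 : 0 ≤ t := by rw [ht, e4]; nlinarith
  have ht1 : t < 1 := by rw [ht, e4]; nlinarith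
  have hd : ∀ j < k + 2, (1 / 4 : ℝ) ^ k ≤ ‖diskAut (dyadicZero j) t‖ := by
    intro j _
    rw [dyadicZero_eq]
    refine le_trans ?_ (abs_sub_le_norm_diskAut_ofReal (by linarith [half_pow_succ_le_half j])
      (by linarith [show (0 : ℝ) < (1 / 2) ^ (j + 1) by positivity]) ht0 ht1)
    rcases lt_trichotomy (j + 1) k with h | h | h
    · have h1 : (1 / 2 : ℝ) ^ k ≤ (1 / 2) ^ (j + 2) :=
        pow_le_pow_of_le_one (by norm_num) (by norm_num) h
      have h2 : (1 / 2 : ℝ) ^ (j + 1) = 2 * (1 / 2) ^ (j + 2) := by rw [pow_succ _ (j + 1)]; ring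
      refine le_trans ?_ (neg_le_abs _)
      rw [ht, e4]; nlinarith
    · rw [h]
      refine le_trans ?_ (le_abs_self _)
      rw [ht]; linarith
    · have h1 : (1 / 2 : ℝ) ^ (j + 1) ≤ (1 / 2) ^ k :=
        pow_le_pow_of_le_one (by norm_num) (by norm_num) h.le
      refine le_trans ?_ (le_abs_self _)
      rw [ht]; linarith
  have hnt : ‖(t : ℂ)‖ = t := by rw [Complex.norm_real, Real.norm_of_nonneg ht0]
  have h3 := isBlaschkeSeq_dyadicZero.prod_mul_half_le_norm one_sub_norm_dyadicZero
    (z := t) (by rw [hnt]; exact ht1) (N := k + 2)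
    (by rw [hnt, ht, pow_add, e4]; nlinarith)
    (d := fun _ => (1 / 4) ^ k) (fun j _ => by positivity) hd
  refine le_trans ?_ h3
  refine (targetModulus_le_exp_two_pow k).trans ?_
  have hexp : Real.exp (-2) ≤ 1 / 4 := by
    rw [Real.exp_neg, show (2 : ℝ) = 1 + 1 by norm_num, Real.exp_add,
      inv_le_comm₀ (by positivity) (by norm_num)]
    nlinarith [Real.exp_one_gt_d9]
  calc Real.exp (-(2 ^ k / 2)) ≤ Real.exp (((k * (k + 2) + 1 : ℕ) : ℝ) * (-2)) := by
        refine Real.exp_le_exp.2 ?_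
        push_cast
        nlinarith [four_mul_succ_sq_le_two_pow hk]
    _ = Real.exp (-2) ^ (k * (k + 2) + 1) := Real.exp_nat_mul _ _
    _ ≤ (1 / 4) ^ (k * (k + 2) + 1) := by gcongr
    _ ≤ _ := by
        rw [Finset.prod_const, Finset.card_range, ← pow_mul, pow_succ]
        gcongr
        norm_num

theorem exists_norm_blaschkeFun_eq {k : ℕ} (hk : 1 ≤ k) :
    ∃ t : ℝ, 0 < t ∧ t < 1 ∧ ‖blaschkeFun dyadicZero t‖ = targetModulus k ∧
      (10 ≤ k → 1 - (1 / 2) ^ k - (1 / 4) ^ k ≤ t ∧ t ≤ 1 - (1 / 2) ^ k) := by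
  obtain ⟨j, rfl⟩ : ∃ j, k = j + 1 := ⟨k - 1, by omega⟩
  have hx : (0 : ℝ) < (1 / 2) ^ (j + 1) := by positivity
  have hx1 := half_pow_succ_le_half j
  have hzero : ‖blaschkeFun dyadicZero ((1 - (1 / 2) ^ (j + 1) : ℝ) : ℂ)‖ = 0 := by
    rw [← dyadicZero_eq, isBlaschkeSeq_dyadicZero.apply_eq_zero, norm_zero]
  have hIVT : ∀ l : ℝ, 0 ≤ l → l ≤ 1 - (1 / 2) ^ (j + 1) →
      targetModulus (j + 1) ≤ ‖blaschkeFun dyadicZero l‖ →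
      ∃ t ∈ Icc l (1 - (1 / 2) ^ (j + 1)), ‖blaschkeFun dyadicZero t‖ = targetModulus (j + 1) := by
    intro l hl hlz hv
    refine intermediate_value_Icc' hlz
      ((continuousOn_norm_blaschkeFun_ofReal isBlaschkeSeq_dyadicZero).mono
        fun t ht => ⟨hl.trans ht.1, ht.2.trans_lt (by linarith)⟩) ⟨?_, hv⟩
    rw [hzero]; exact (targetModulus_pos _).le
  have hpos : ∀ t : ℝ, 0 ≤ t → ‖blaschkeFun dyadicZero t‖ = targetModulus (j + 1) → 0 < t := by
    intro t ht h
    refine ht.lt_of_ne ?_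
    rintro rfl
    have := targetModulus_lt_norm_blaschkeFun_zero hk
    rw [← h, Complex.ofReal_zero] at this
    exact lt_irrefl _ this
  by_cases h10 : 10 ≤ j + 1
  · have e4 : (1 / 4 : ℝ) ^ (j + 1) = (1 / 2) ^ (j + 1) * (1 / 2) ^ (j + 1) := by
      rw [← mul_pow]; norm_num
    have hl : (0 : ℝ) ≤ 1 - (1 / 2) ^ (j + 1) - (1 / 4) ^ (j + 1) := by rw [e4]; nlinarith
    obtain ⟨t, ht, h⟩ := hIVT (1 - (1 / 2) ^ (j + 1) - (1 / 4) ^ (j + 1)) hl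
      (by rw [e4]; nlinarith) (targetModulus_le_norm_blaschkeFun h10)
    exact ⟨t, hpos t (hl.trans ht.1) h, by linarith [ht.2], h, fun _ => ⟨ht.1, ht.2⟩⟩
  · obtain ⟨t, ht, h⟩ := hIVT 0 le_rfl (by linarith)
      (by simpa using (targetModulus_lt_norm_blaschkeFun_zero hk).le)
    exact ⟨t, hpos t ht.1 h, by linarith [ht.2], h, fun h => absurd h h10⟩

theorem pseudohypDist_eq (w z : 𝔻) : pseudohypDist w z = ‖diskAut w z‖ := rfl

theorem exists_isNearbySequence : ∃ μ : ℕ → 𝔻, IsNearbySequence μ := by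
  choose! t ht0 ht1 htv htk using fun (k : ℕ) (hk : 1 ≤ k) => exists_norm_blaschkeFun_eq hk
  have hnorm : ∀ k, 1 ≤ k → ‖(t k : ℂ)‖ < 1 := fun k hk => by
    rw [Complex.norm_real, Real.norm_of_nonneg (ht0 k hk).le]; exact ht1 k hk
  -- The value at the irrelevant index `0` is set to `0`.
  set μ : ℕ → 𝔻 := fun k => if hk : 1 ≤ k then Complex.UnitDisc.mk (t k) (hnorm k hk) else 0
    with hμ
  have hμt : ∀ k, 1 ≤ k → (μ k : ℂ) = t k := fun k hk => by
    rw [hμ]; simp only; rw [dif_pos hk, Complex.UnitDisc.coe_mk]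
  refine ⟨μ, fun k hk => ⟨t k, ht0 k hk, ht1 k hk, hμt k hk⟩, ?_, fun k hk => ?_⟩
  · refine squeeze_zero' (g := fun k => (1 / 2 : ℝ) ^ k)
      (Eventually.of_forall fun k => norm_nonneg _) ?_
      (tendsto_pow_atTop_nhds_zero_of_lt_one (by norm_num) (by norm_num))
    filter_upwards [eventually_ge_atTop 10] with k hk
    have hk1 : 1 ≤ k := by omega
    obtain ⟨h1, h2⟩ := htk k hk1 hk
    have hx : (0 : ℝ) < (1 / 2) ^ k := by positivity
    have hzt := ht0 k hk1
    rw [pseudohypDist_eq, hμt k hk1, coe_dyadicPoint, norm_diskAut_ofReal hzt.le h2 (by linarith),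
      div_le_iff₀ (by nlinarith)]
    have e4 : (1 / 4 : ℝ) ^ k = (1 / 2) ^ k * (1 / 2) ^ k := by rw [← mul_pow]; norm_num
    rw [e4] at h1
    nlinarith
  · rw [blaschkeFromOne_dyadicPoint, hμt k hk]
    exact htv k hk

/-! ### Unimodularity of the pair of Blaschke products -/

/-- Two points of `[0, 1)` at small pseudohyperbolic distance have comparable distances to `1`. -/
theorem abs_sub_le_diskAut_mul {x y : ℝ} (hx0 : 0 ≤ x) (hx1 : x < 1) (hy1 : y < 1) :
    |x - y| ≤ ‖diskAut x y‖ * ((1 - x) + (1 - y)) := by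
  have h : diskAut x y = (((x - y) / (1 - y * x) : ℝ) : ℂ) := by
    rw [diskAut, Complex.conj_ofReal]; push_cast; ring
  have hD : 0 < 1 - y * x := by nlinarith
  rw [h, Complex.norm_real, Real.norm_eq_abs, abs_div, abs_of_pos hD, div_mul_eq_mul_div,
    le_div_iff₀ hD]
  gcongr
  nlinarith

/-- The distances of `μ k` and `1 - 2⁻ᵏ` to the point `1` are asymptotically equal. -/
theorem IsNearbySequence.tendsto_ratio {μ : ℕ → 𝔻} (hμ : IsNearbySequence μ) :
    Tendsto (fun k => (1 - ‖(μ k : ℂ)‖) * 2 ^ k) atTop (𝓝 1) := by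
  obtain ⟨hreal, hρ, -⟩ := hμ
  rw [tendsto_iff_dist_tendsto_zero]
  have h2 : ∀ᶠ k in atTop, pseudohypDist (μ k) (dyadicPoint k) < 1 / 2 :=
    hρ.eventually_lt_const (by norm_num)
  refine squeeze_zero' (g := fun k => 4 * pseudohypDist (μ k) (dyadicPoint k))
    (Eventually.of_forall fun k => dist_nonneg) ?_ (by simpa using hρ.const_mul 4)
  filter_upwards [h2, eventually_ge_atTop 1] with k hk hk1
  obtain ⟨t, ht0, ht1, ht⟩ := hreal k hk1
  have hn : ‖(μ k : ℂ)‖ = t := by rw [ht, Complex.norm_real, Real.norm_of_nonneg ht0.le]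
  have hx : (0 : ℝ) < (1 / 2) ^ k := by positivity
  have hx1 : (1 / 2 : ℝ) ^ k ≤ 1 := pow_le_one₀ (by norm_num) (by norm_num)
  have h := abs_sub_le_diskAut_mul (x := t) (y := 1 - (1 / 2) ^ k) ht0.le ht1 (by linarith)
  rw [hn, Real.dist_eq]
  rw [pseudohypDist_eq, ht, coe_dyadicPoint] at hk ⊢
  set ρ := ‖diskAut t ((1 - (1 / 2) ^ k : ℝ) : ℂ)‖
  have hρ0 : 0 ≤ ρ := norm_nonneg _
  have h3 : (2 : ℝ) ^ k * (1 / 2) ^ k = 1 := by rw [← mul_pow]; norm_num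
  have h2k : (0 : ℝ) < 2 ^ k := by positivity
  have e : (1 - t) * 2 ^ k - 1 = -((t - (1 - (1 / 2) ^ k)) * 2 ^ k) := by
    linear_combination h3
  rw [e, abs_neg, abs_mul, abs_of_pos h2k]
  have h4 : 1 - t ≤ 3 * (1 / 2) ^ k := by
    have := (abs_le.1 h).1
    nlinarith
  calc |t - (1 - (1 / 2) ^ k)| * 2 ^ k ≤ ρ * ((1 - t) + (1 - (1 - (1 / 2) ^ k))) * 2 ^ k := by
        gcongr
    _ ≤ ρ * (4 * (1 / 2) ^ k) * 2 ^ k := by gcongr; linarith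
    _ = 4 * ρ := by linear_combination (4 * ρ) * h3

theorem IsNearbySequence.exists_le_geometric {μ : ℕ → 𝔻} (hμ : IsNearbySequence μ) :
    ∃ C : ℝ, ∀ j, 1 - ‖(μ (j + 1) : ℂ)‖ ≤ C * (1 / 2) ^ j := by
  obtain ⟨C, hC⟩ := hμ.tendsto_ratio.bddAbove_range
  have hC' : ∀ k, (1 - ‖(μ k : ℂ)‖) * 2 ^ k ≤ C := fun k => hC ⟨k, rfl⟩
  refine ⟨C / 2, fun j => ?_⟩
  have h := hC' (j + 1)
  have h3 : (2 : ℝ) ^ (j + 1) * (1 / 2) ^ (j + 1) = 1 := by rw [← mul_pow]; norm_num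
  calc 1 - ‖(μ (j + 1) : ℂ)‖
      = (1 - ‖(μ (j + 1) : ℂ)‖) * 2 ^ (j + 1) * (1 / 2) ^ (j + 1) := by rw [mul_assoc, h3, mul_one]
    _ ≤ C * (1 / 2) ^ (j + 1) := by gcongr
    _ = C / 2 * (1 / 2) ^ j := by rw [pow_succ]; ring

theorem IsNearbySequence.isBlaschkeSeq {μ : ℕ → 𝔻} (hμ : IsNearbySequence μ) :
    IsBlaschkeSeq fun j => (μ (j + 1) : ℂ) := by
  obtain ⟨C, hC⟩ := hμ.exists_le_geometric
  refine isBlaschkeSeq_of_le_geometric (fun k => ?_) (fun k => (μ (k + 1)).norm_lt_one) hC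
  obtain ⟨t, ht0, -, ht⟩ := hμ.1 (k + 1) (by omega)
  rw [ht]; exact_mod_cast ht0.ne'

theorem norm_diskAut_comm (a z : ℂ) : ‖diskAut a z‖ = ‖diskAut z a‖ := by
  rw [diskAut, diskAut, norm_div, norm_div, norm_sub_rev, ← RCLike.norm_conj (1 - z * conj a)]
  simp [mul_comm]

theorem norm_sub_le_two_mul_norm_diskAut {a z : ℂ} (ha : ‖a‖ < 1) (hz : ‖z‖ < 1) :
    ‖a - z‖ ≤ 2 * ‖diskAut a z‖ := by
  have hD := norm_pos_iff.2 (one_sub_mul_conj_ne_zero ha hz)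
  rw [diskAut, norm_div, ← mul_div_assoc, le_div_iff₀ hD, mul_comm]
  gcongr
  refine (norm_sub_le _ _).trans ?_
  rw [norm_one, norm_mul, RCLike.norm_conj]
  nlinarith [norm_nonneg a, norm_nonneg z]

theorem exp_neg_one_le_half : Real.exp (-1) ≤ 1 / 2 := by
  rw [Real.exp_neg, inv_le_comm₀ (by positivity) (by norm_num)]
  linarith [Real.exp_one_gt_d9]

/-- The second Blaschke product is at least `exp (-K / (1 - |z|))` at the zeros `z` of the first.
Since `|B₁|` is at most the pseudohyperbolic distance to each of its zeros, the prescribed values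
of `|B₁|` at the zeros of `B₂` separate these zeros from those of `B₁`. -/
theorem IsNearbySequence.exists_exp_le_norm {μ : ℕ → 𝔻} (hμ : IsNearbySequence μ) :
    ∃ K : ℝ, 0 ≤ K ∧ ∀ k, Real.exp (-(K * 2 ^ k)) ≤
      ‖blaschkeFun (fun j => (μ (j + 1) : ℂ)) (dyadicZero k)‖ := by
  obtain ⟨C, hC⟩ := hμ.exists_le_geometric
  -- Only the first `k + 1 + p` factors have to be bounded individually, with `p` fixed.
  obtain ⟨p, hp⟩ := pow_unbounded_of_one_lt (8 * C) (by norm_num : (1 : ℝ) < 2)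
  refine ⟨4 * 2 ^ (p + 1) + 1, by positivity, fun k => ?_⟩
  have h3 : (2 : ℝ) ^ p * (1 / 2) ^ p = 1 := by rw [← mul_pow]; norm_num
  have h := hμ.isBlaschkeSeq.prod_mul_half_le_norm hC (z := dyadicZero k)
    (norm_dyadicZero_lt_one k) (N := k + 1 + p)
    (by
      rw [norm_dyadicZero, sub_sub_cancel, pow_add _ (k + 1) p]
      calc 8 * C * ((1 / 2) ^ (k + 1) * (1 / 2) ^ p)
          ≤ 2 ^ p * ((1 / 2) ^ (k + 1) * (1 / 2) ^ p) := by gcongr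
        _ = (1 / 2 : ℝ) ^ (k + 1) := by linear_combination (1 / 2 : ℝ) ^ (k + 1) * h3)
    (d := fun j => Real.exp (-(4 * 2 ^ j))) (fun j _ => (Real.exp_pos _).le)
    (fun j _ => by
      rw [norm_diskAut_comm]
      refine le_trans ?_
        (isBlaschkeSeq_dyadicZero.norm_le_diskAut (μ (j + 1)).norm_lt_one k)
      have h1 : ‖blaschkeFun dyadicZero (μ (j + 1))‖ = targetModulus (j + 1) :=
        hμ.2.2 (j + 1) (by omega)
      rw [h1]
      refine le_trans (le_of_eq ?_) (le_targetModulus (j + 1))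
      rw [pow_succ]; ring_nf)
  refine le_trans ?_ h
  rw [← Real.exp_sum]
  calc _ ≤ Real.exp (∑ j ∈ Finset.range (k + 1 + p), -(4 * 2 ^ j) + -1) := by
        refine Real.exp_le_exp.2 ?_
        rw [Finset.sum_neg_distrib, ← Finset.mul_sum, geom_sum_eq (by norm_num)]
        have : (1 : ℝ) ≤ 2 ^ k := one_le_pow₀ (by norm_num)
        have e : (2 : ℝ) ^ (k + 1 + p) = 2 ^ (p + 1) * 2 ^ k := by ring
        rw [e]
        norm_num
        nlinarith
    _ ≤ _ := by rw [Real.exp_add]; gcongr; exact exp_neg_one_le_half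

/-- The dyadic sequence with the `k`-th zero replaced by a second copy of the next one: its
Blaschke product vanishes at all dyadic zeros except the `k`-th. -/
noncomputable def punctured (k : ℕ) : ℕ → ℂ :=
  Function.update dyadicZero k (dyadicZero (k + 1))

theorem exists_punctured_eq (k j : ℕ) : ∃ i, j ≤ i ∧ i ≠ k ∧ punctured k j = dyadicZero i := by
  rcases eq_or_ne j k with rfl | h
  · exact ⟨j + 1, by omega, by omega, Function.update_self ..⟩
  · exact ⟨j, le_rfl, h, Function.update_of_ne h ..⟩

theorem one_sub_norm_punctured (k j : ℕ) : 1 - ‖punctured k j‖ ≤ 1 / 2 * (1 / 2) ^ j := by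
  obtain ⟨i, hi, -, h⟩ := exists_punctured_eq k j
  rw [h]
  refine (one_sub_norm_dyadicZero i).trans ?_
  gcongr ?_ * ?_
  exact pow_le_pow_of_le_one (by norm_num) (by norm_num) hi

theorem isBlaschkeSeq_punctured (k : ℕ) : IsBlaschkeSeq (punctured k) := by
  refine isBlaschkeSeq_of_le_geometric (fun j => ?_) (fun j => ?_) (one_sub_norm_punctured k)
  all_goals
    obtain ⟨i, -, -, h⟩ := exists_punctured_eq k j
    rw [h]
  · exact dyadicZero_ne_zero i
  · exact norm_dyadicZero_lt_one i

theorem blaschkeFun_punctured_eq_zero {k j : ℕ} (h : j ≠ k) :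
    blaschkeFun (punctured k) (dyadicZero j) = 0 := by
  have := (isBlaschkeSeq_punctured k).apply_eq_zero j
  rwa [show punctured k j = dyadicZero j from Function.update_of_ne h ..] at this

theorem half_pow_le_norm_dyadicZero_sub {i k : ℕ} (h : i ≠ k) :
    (1 / 2 : ℝ) ^ (k + 2) ≤ ‖dyadicZero i - dyadicZero k‖ := by
  have e : dyadicZero i - dyadicZero k = (((1 / 2) ^ (k + 1) - (1 / 2) ^ (i + 1) : ℝ) : ℂ) := by
    rw [dyadicZero_eq, dyadicZero_eq]; push_cast; ring
  rw [e, Complex.norm_real, Real.norm_eq_abs]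
  have e1 : (1 / 2 : ℝ) ^ (k + 1) = 2 * (1 / 2) ^ (k + 2) := by rw [pow_succ _ (k + 1)]; ring
  rcases lt_or_gt_of_ne h with h | h
  · have h1 : (1 / 2 : ℝ) ^ k ≤ (1 / 2) ^ (i + 1) :=
      pow_le_pow_of_le_one (by norm_num) (by norm_num) h
    have e2 : (1 / 2 : ℝ) ^ k = 4 * (1 / 2) ^ (k + 2) := by rw [pow_add]; ring
    have : (0 : ℝ) < (1 / 2) ^ (k + 2) := by positivity
    refine le_trans ?_ (neg_le_abs _)
    linarith
  · have h1 : (1 / 2 : ℝ) ^ (i + 1) ≤ (1 / 2) ^ (k + 2) :=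
      pow_le_pow_of_le_one (by norm_num) (by norm_num) (by omega)
    refine le_trans ?_ (le_abs_self _)
    linarith

theorem add_three_sq_add_one_le (k : ℕ) : ((k : ℝ) + 3) * (k + 3) + 1 ≤ 13 * 2 ^ k := by
  induction k with
  | zero => norm_num
  | succ k ih =>
    have h1 : (k : ℝ) + 1 ≤ 2 ^ k := by exact_mod_cast Nat.lt_two_pow_self (n := k)
    rw [pow_succ]; push_cast
    nlinarith

theorem exp_le_norm_blaschkeFun_punctured (k : ℕ) :
    Real.exp (-(13 * 2 ^ k)) ≤ ‖blaschkeFun (punctured k) (dyadicZero k)‖ := by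
  have h := (isBlaschkeSeq_punctured k).prod_mul_half_le_norm (one_sub_norm_punctured k)
    (z := dyadicZero k) (norm_dyadicZero_lt_one k) (N := k + 3)
    (by rw [norm_dyadicZero]; ring_nf; rfl)
    (d := fun _ => (1 / 2) ^ (k + 3)) (fun j _ => by positivity)
    (fun j _ => by
      obtain ⟨i, -, hik, hi⟩ := exists_punctured_eq k j
      have h1 := norm_sub_le_two_mul_norm_diskAut (norm_dyadicZero_lt_one i)
        (norm_dyadicZero_lt_one k)
      have h2 := half_pow_le_norm_dyadicZero_sub hik
      rw [hi, pow_succ]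
      linarith)
  refine le_trans ?_ h
  rw [Finset.prod_const, Finset.card_range, ← pow_mul, ← pow_succ]
  have hk := add_three_sq_add_one_le k
  calc Real.exp (-(13 * 2 ^ k)) ≤ Real.exp ((((k + 3) * (k + 3) + 1 : ℕ) : ℝ) * (-1)) := by
        refine Real.exp_le_exp.2 ?_
        push_cast
        linarith
    _ = Real.exp (-1) ^ ((k + 3) * (k + 3) + 1) := Real.exp_nat_mul _ _
    _ ≤ _ := by gcongr; exact exp_neg_one_le_half

/-- The real part of this function is the Poisson kernel of the boundary point `1`. -/
noncomputable def poissonFun (z : ℂ) : ℂ := (1 + z) / (1 - z)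

theorem one_sub_ne_zero_of_mem_ball {z : ℂ} (hz : z ∈ ball (0 : ℂ) 1) : 1 - z ≠ 0 := by
  intro h
  rw [mem_ball_zero_iff, ← sub_eq_zero.1 h, norm_one] at hz
  exact lt_irrefl _ hz

theorem differentiableOn_poissonFun : DifferentiableOn ℂ poissonFun (ball 0 1) :=
  DifferentiableOn.div (by fun_prop) (by fun_prop) fun _ hz => one_sub_ne_zero_of_mem_ball hz

theorem poissonFun_re_nonneg {z : ℂ} (hz : z ∈ ball (0 : ℂ) 1) : 0 ≤ (poissonFun z).re := by
  rw [poissonFun, Complex.div_re, ← add_div]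
  refine div_nonneg ?_ (Complex.normSq_nonneg _)
  have h : Complex.normSq z < 1 := by
    rw [Complex.normSq_eq_norm_sq]
    have := mem_ball_zero_iff.1 hz
    nlinarith [norm_nonneg z]
  rw [Complex.normSq_apply] at h
  simp only [Complex.add_re, Complex.sub_re, Complex.add_im, Complex.sub_im, Complex.one_re,
    Complex.one_im]
  nlinarith

theorem poissonFun_dyadicZero_re (k : ℕ) : 2 ^ k ≤ (poissonFun (dyadicZero k)).re := by
  have e : poissonFun (dyadicZero k) =
      (((1 + (1 - (1 / 2) ^ (k + 1))) / (1 - (1 - (1 / 2) ^ (k + 1))) : ℝ) : ℂ) := by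
    rw [poissonFun, dyadicZero_eq]; push_cast; ring
  have hx : (0 : ℝ) < (1 / 2) ^ (k + 1) := by positivity
  rw [e, Complex.ofReal_re, sub_sub_cancel, le_div_iff₀ hx]
  have h3 : (2 : ℝ) ^ k * (1 / 2) ^ k = 1 := by rw [← mul_pow]; norm_num
  have : (2 : ℝ) ^ k * (1 / 2) ^ (k + 1) = 1 / 2 := by rw [pow_succ]; linear_combination h3 / 2
  linarith [half_pow_succ_le_half k]

/-- Interpolation at the dyadic zeros by a bounded holomorphic function, for data decaying like
`exp (-14 * 2 ^ k)`: a Lagrange series whose basis functions are Blaschke products. -/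
theorem exists_bounded_interpolation {w : ℕ → ℂ} (hw : ∀ k, ‖w k‖ ≤ Real.exp (-(14 * 2 ^ k))) :
    ∃ (g : ℂ → ℂ) (W : ℝ), DifferentiableOn ℂ g (ball 0 1) ∧ (∀ z ∈ ball (0 : ℂ) 1, ‖g z‖ ≤ W) ∧
      ∀ k, g (dyadicZero k) = w k := by
  set c : ℕ → ℂ := fun k => w k / blaschkeFun (punctured k) (dyadicZero k) with hc
  have hpos : ∀ k, 0 < ‖blaschkeFun (punctured k) (dyadicZero k)‖ := fun k =>
    (Real.exp_pos _).trans_le (exp_le_norm_blaschkeFun_punctured k)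
  have hcb : ∀ k, ‖c k‖ ≤ Real.exp (-k) := by
    intro k
    rw [hc]; simp only
    rw [norm_div, div_le_iff₀ (hpos k)]
    calc ‖w k‖ ≤ Real.exp (-(14 * 2 ^ k)) := hw k
      _ ≤ Real.exp (-k + -(13 * 2 ^ k)) := by
          refine Real.exp_le_exp.2 ?_
          have : (k : ℝ) ≤ 2 ^ k := by exact_mod_cast (Nat.lt_two_pow_self (n := k)).le
          linarith
      _ ≤ _ := by
          rw [Real.exp_add]
          gcongr
          exact exp_le_norm_blaschkeFun_punctured k
  have hterm : ∀ k, ∀ z ∈ ball (0 : ℂ) 1, ‖c k * blaschkeFun (punctured k) z‖ ≤ Real.exp (-k) := by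
    intro k z hz
    rw [norm_mul]
    refine (mul_le_of_le_one_right (norm_nonneg _) ?_).trans (hcb k)
    exact (isBlaschkeSeq_punctured k).norm_le_one (by simpa using hz)
  refine ⟨fun z => ∑' k, c k * blaschkeFun (punctured k) z, ∑' k : ℕ, Real.exp (-k), ?_, ?_, ?_⟩
  · exact Complex.differentiableOn_tsum_of_summable_norm Real.summable_exp_neg_nat
      (fun k => (isBlaschkeSeq_punctured k).differentiableOn.const_mul _) isOpen_ball hterm
  · intro z hz
    exact tsum_of_norm_bounded Real.summable_exp_neg_nat.hasSum fun k => hterm k z hz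
  · intro k
    simp only
    rw [tsum_eq_single k fun j hj => by rw [blaschkeFun_punctured_eq_zero hj.symm, mul_zero], hc]
    exact div_mul_cancel₀ _ (norm_pos_iff.1 (hpos k))

theorem IsNevanlinna.of_norm_le {F : ℂ → ℂ} {M : ℝ} (hF : DifferentiableOn ℂ F (ball 0 1))
    (hM : ∀ z ∈ ball (0 : ℂ) 1, ‖F z‖ ≤ M) : IsNevanlinna fun z : 𝔻 => F z := by
  have hM0 : 0 ≤ M := (norm_nonneg _).trans (hM 0 (by simp))
  refine ⟨⟨F, hF, fun _ => rfl⟩, fun _ => M, ⟨harmonicOnNhd_const _, fun _ => hM0⟩, fun z => ?_⟩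
  have h1 := hM z (mem_ball_zero_iff.2 z.norm_lt_one)
  have h2 := Real.log_le_self (norm_nonneg (F z))
  exact h2.trans h1

theorem IsNevanlinna.exp_mul_poissonFun {s : ℝ} (hs : 0 ≤ s) :
    IsNevanlinna fun z : 𝔻 => Complex.exp (s * poissonFun z) := by
  have hd : DifferentiableOn ℂ (fun z => (s : ℂ) * poissonFun z) (ball 0 1) :=
    differentiableOn_poissonFun.const_mul _
  refine ⟨⟨fun z => Complex.exp (s * poissonFun z), hd.cexp, fun _ => rfl⟩,
    fun z => ((s : ℂ) * poissonFun z).re, ⟨fun z hz => ?_, fun z => ?_⟩, fun z => ?_⟩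
  · exact (hd.analyticAt (isOpen_ball.mem_nhds hz)).harmonicAt_re
  · simp only
    rw [Complex.re_ofReal_mul]
    exact mul_nonneg hs (poissonFun_re_nonneg (mem_ball_zero_iff.2 z.norm_lt_one))
  · rw [Complex.norm_exp, Real.log_exp]

theorem IsBlaschkeSeq.isNevanlinna {a : ℕ → ℂ} (ha : IsBlaschkeSeq a) :
    IsNevanlinna fun z : 𝔻 => blaschkeFun a z :=
  IsNevanlinna.of_norm_le ha.differentiableOn fun _ hz => ha.norm_le_one (mem_ball_zero_iff.1 hz)

/-- A Bézout identity for the two Blaschke products, whose coefficients are bounded holomorphic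
functions times `exp (s P)`, with `P` the holomorphic completion of the Poisson kernel. -/
theorem IsNearbySequence.exists_bezout {μ : ℕ → 𝔻} (hμ : IsNearbySequence μ) :
    ∃ f g : 𝔻 → ℂ, IsNevanlinna f ∧ IsNevanlinna g ∧
      ∀ z, f z * blaschkeFromOne dyadicPoint z + g z * blaschkeFromOne μ z = 1 := by
  set B₂ : ℂ → ℂ := blaschkeFun fun j => (μ (j + 1) : ℂ) with hB₂
  have hB := hμ.isBlaschkeSeq
  obtain ⟨K, hK0, hK⟩ := hμ.exists_exp_le_norm
  have hBpos : ∀ k, 0 < ‖B₂ (dyadicZero k)‖ := fun k => (Real.exp_pos _).trans_le (hK k)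
  -- `K` absorbs the size of `1 / B₂` at the dyadic zeros; `14` is what the interpolation needs.
  set s : ℝ := K + 14 with hs
  have hs0 : 0 ≤ s := by positivity
  set E : ℂ → ℂ := fun z => Complex.exp (-(s * poissonFun z)) with hE
  have hEd : DifferentiableOn ℂ E (ball 0 1) :=
    ((differentiableOn_poissonFun.const_mul (s : ℂ)).neg).cexp
  have hEn : ∀ z, ‖E z‖ = Real.exp (-(s * (poissonFun z).re)) := fun z => by
    rw [hE]; simp only
    rw [Complex.norm_exp, Complex.neg_re, Complex.re_ofReal_mul]
  obtain ⟨g, W, hgd, hgW, hg⟩ := exists_bounded_interpolation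
    (w := fun k => E (dyadicZero k) / B₂ (dyadicZero k)) (fun k => by
      rw [norm_div, div_le_iff₀ (hBpos k), hEn]
      calc Real.exp (-(s * (poissonFun (dyadicZero k)).re))
          ≤ Real.exp (-(14 * 2 ^ k) + -(K * 2 ^ k)) := by
            refine Real.exp_le_exp.2 ?_
            have := mul_le_mul_of_nonneg_left (poissonFun_dyadicZero_re k) hs0
            rw [hs] at this ⊢
            linarith
        _ ≤ _ := by
            rw [Real.exp_add]
            gcongr
            exact hK k)
  have hQd : DifferentiableOn ℂ (fun z => E z - g z * B₂ z) (ball 0 1) :=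
    hEd.sub (hgd.mul hB.differentiableOn)
  have hQb : ∀ z ∈ ball (0 : ℂ) 1, ‖E z - g z * B₂ z‖ ≤ 1 + W := by
    intro z hz
    refine (norm_sub_le _ _).trans (add_le_add ?_ ?_)
    · rw [hEn, Real.exp_le_one_iff, neg_nonpos]
      exact mul_nonneg hs0 (poissonFun_re_nonneg hz)
    · rw [norm_mul]
      exact (mul_le_of_le_one_right (norm_nonneg _)
        (hB.norm_le_one (mem_ball_zero_iff.1 hz))).trans (hgW z hz)
  have hQ0 : ∀ k, E (dyadicZero k) - g (dyadicZero k) * B₂ (dyadicZero k) = 0 := by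
    intro k
    rw [hg, div_mul_cancel₀ _ (norm_pos_iff.1 (hBpos k)), sub_self]
  obtain ⟨q, hqd, hqb, hq⟩ := exists_eq_mul_of_norm_le_mul_norm isOpen_ball
    (convex_ball (0 : ℂ) 1).isPreconnected hQd isBlaschkeSeq_dyadicZero.differentiableOn
    ⟨0, by simp, norm_pos_iff.1
      ((targetModulus_pos 1).trans (targetModulus_lt_norm_blaschkeFun_zero le_rfl))⟩
    (fun z hz => isBlaschkeSeq_dyadicZero.norm_le_mul_norm dyadicZero_injective hQd hQb hQ0
      (mem_ball_zero_iff.1 hz))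
  refine ⟨(fun z : 𝔻 => Complex.exp (s * poissonFun z)) * fun z : 𝔻 => q z,
    (fun z : 𝔻 => Complex.exp (s * poissonFun z)) * fun z : 𝔻 => g z,
    (IsNevanlinna.exp_mul_poissonFun hs0).mul (IsNevanlinna.of_norm_le hqd hqb),
    (IsNevanlinna.exp_mul_poissonFun hs0).mul (IsNevanlinna.of_norm_le hgd hgW), fun z => ?_⟩
  have h1 := hq z (mem_ball_zero_iff.2 z.norm_lt_one)
  have h2 : Complex.exp (s * poissonFun z) * E z = 1 := by
    rw [hE]; simp only
    rw [← Complex.exp_add, add_neg_cancel, Complex.exp_zero]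
  have h3 : blaschkeFromOne μ z = B₂ z := rfl
  rw [blaschkeFromOne_dyadicPoint, h3, Pi.mul_apply, Pi.mul_apply]
  linear_combination (-Complex.exp (s * poissonFun z)) * h1 + h2

/-! ### Radial behaviour of zero-free Nevanlinna functions -/

theorem IsNevanlinna.exists_tendsto_log_norm {u : 𝔻 → ℂ} (hu : IsNevanlinna u)
    (hu0 : ∀ z, u z ≠ 0) :
    ∃ (F : ℂ → ℂ) (L : ℝ), (∀ z : 𝔻, F z = u z) ∧
      Tendsto (fun r : ℝ => Real.log ‖F r‖ * ((1 - r) / (1 + r))) (𝓝[<] 1) (𝓝 L) := by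
  obtain ⟨⟨F, hF, hFu⟩, h, ⟨hh, hh0⟩, hle⟩ := hu
  have hmk : ∀ z ∈ ball (0 : ℂ) 1, ∃ w : 𝔻, (w : ℂ) = z := fun z hz =>
    ⟨Complex.UnitDisc.mk z (mem_ball_zero_iff.1 hz), Complex.UnitDisc.coe_mk _ _⟩
  have hlog : HarmonicOnNhd (fun z => Real.log ‖F z‖) (ball 0 1) := fun z hz => by
    refine (hF.analyticAt (isOpen_ball.mem_nhds hz)).harmonicAt_log_norm ?_
    obtain ⟨w, rfl⟩ := hmk z hz
    rw [hFu]; exact hu0 w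
  -- `log |u|` is the difference of the positive harmonic functions `h + 1` and `h + 1 - log |u|`.
  obtain ⟨L₁, hL₁⟩ := exists_tendsto_mul_of_harmonic_pos (hh.add (harmonicOnNhd_const (1 : ℝ)))
    (fun z hz => by
      obtain ⟨w, rfl⟩ := hmk z hz
      have := hh0 w
      simp only [Pi.add_apply]; linarith)
  obtain ⟨L₂, hL₂⟩ := exists_tendsto_mul_of_harmonic_pos
    ((hh.add (harmonicOnNhd_const (1 : ℝ))).sub hlog) (fun z hz => by
      obtain ⟨w, rfl⟩ := hmk z hz
      have := hle w
      rw [← hFu] at this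
      simp only [Pi.add_apply, Pi.sub_apply]; linarith)
  refine ⟨F, L₁ - L₂, hFu, (hL₁.sub hL₂).congr fun r => ?_⟩
  simp only [Pi.add_apply, Pi.sub_apply]
  ring

theorem log_targetModulus (k : ℕ) : Real.log (targetModulus k) =
    (if Even k then -1 else -2) / ((1 / 2) ^ k * (2 - (1 / 2) ^ k)) := by
  rw [targetModulus, ← one_sub_norm_dyadicPoint_sq]
  split_ifs <;> rw [Real.log_exp]

theorem IsNearbySequence.tendsto_norm {μ : ℕ → 𝔻} (hμ : IsNearbySequence μ) :
    Tendsto (fun k => ‖(μ k : ℂ)‖) atTop (𝓝 1) := by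
  have hpow : Tendsto (fun k : ℕ => (1 / 2 : ℝ) ^ k) atTop (𝓝 0) :=
    tendsto_pow_atTop_nhds_zero_of_lt_one (by norm_num) (by norm_num)
  have h := (tendsto_const_nhds (x := (1 : ℝ))).sub (hμ.tendsto_ratio.mul hpow)
  rw [mul_zero, sub_zero] at h
  refine h.congr fun k => ?_
  have h3 : (2 : ℝ) ^ k * (1 / 2) ^ k = 1 := by rw [← mul_pow]; norm_num
  linear_combination (‖(μ k : ℂ)‖ - 1) * h3

/-- Along the sequence, `log |B₁ (μ k)|` divided by the Poisson kernel of the point `1` is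
asymptotic to `-1/4` for even `k` and to `-1/2` for odd `k`. -/
theorem IsNearbySequence.exists_tendsto_quarter {μ : ℕ → 𝔻} (hμ : IsNearbySequence μ) :
    ∃ G : ℕ → ℝ, Tendsto G atTop (𝓝 (1 / 4)) ∧ ∀ k,
      Real.log (targetModulus k) * ((1 - ‖(μ k : ℂ)‖) / (1 + ‖(μ k : ℂ)‖)) =
        (if Even k then -1 else -2) * G k := by
  have hpow : Tendsto (fun k : ℕ => (1 / 2 : ℝ) ^ k) atTop (𝓝 0) :=
    tendsto_pow_atTop_nhds_zero_of_lt_one (by norm_num) (by norm_num)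
  refine ⟨fun k => (1 - ‖(μ k : ℂ)‖) * 2 ^ k / ((2 - (1 / 2) ^ k) * (1 + ‖(μ k : ℂ)‖)), ?_,
    fun k => ?_⟩
  · have := hμ.tendsto_ratio.div ((hpow.const_sub 2).mul (hμ.tendsto_norm.const_add 1))
      (by norm_num)
    rwa [show (1 : ℝ) / ((2 - 0) * (1 + 1)) = 1 / 4 by norm_num] at this
  · have hx1 : (1 / 2 : ℝ) ^ k ≤ 1 := pow_le_one₀ (by norm_num) (by norm_num)
    have h1 : (2 : ℝ) - (1 / 2) ^ k ≠ 0 := by linarith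
    have h2 : 1 + ‖(μ k : ℂ)‖ ≠ 0 := by positivity
    have hx0 : (1 / 2 : ℝ) ^ k ≠ 0 := by positivity
    have h3 : (2 : ℝ) ^ k = ((1 / 2) ^ k)⁻¹ := by rw [← inv_pow]; norm_num
    simp only
    rw [log_targetModulus, h3]
    generalize (1 / 2 : ℝ) ^ k = x at *
    field_simp

/-- A zero-free Nevanlinna function cannot agree with `B₁` on the sequence: its logarithmic modulus
would have two different radial limits at `1` after division by the Poisson kernel. -/
theorem IsNearbySequence.false_of_ne_zero_of_apply_eq {μ : ℕ → 𝔻} (hμ : IsNearbySequence μ)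
    {u : 𝔻 → ℂ} (hu : IsNevanlinna u) (hu0 : ∀ z, u z ≠ 0)
    (huμ : ∀ k, 1 ≤ k → u (μ k) = blaschkeFromOne dyadicPoint (μ k)) : False := by
  obtain ⟨F, L, hFu, hL⟩ := hu.exists_tendsto_log_norm hu0
  obtain ⟨G, hG, hGeq⟩ := hμ.exists_tendsto_quarter
  have hnorm : Tendsto (fun k => ‖(μ k : ℂ)‖) atTop (𝓝[<] 1) :=
    tendsto_nhdsWithin_iff.2 ⟨hμ.tendsto_norm, Eventually.of_forall fun k => (μ k).norm_lt_one⟩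
  have hlim : Tendsto (fun k => (if Even k then -1 else -2) * G k) atTop (𝓝 L) := by
    refine (hL.comp hnorm).congr' ?_
    filter_upwards [eventually_ge_atTop 1] with k hk
    obtain ⟨t, ht0, -, ht⟩ := hμ.1 k hk
    have hn : ((‖(μ k : ℂ)‖ : ℝ) : ℂ) = μ k := by
      rw [ht, Complex.norm_real, Real.norm_of_nonneg ht0.le]
    have hB : ‖blaschkeFromOne dyadicPoint (μ k)‖ = targetModulus k := hμ.2.2 k hk
    rw [Function.comp_apply, hn, hFu, huμ k hk, hB, hGeq]
  have heven : Tendsto (fun n : ℕ => 2 * n) atTop atTop :=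
    tendsto_atTop_mono (fun n => (by omega : n ≤ 2 * n)) tendsto_id
  have hodd : Tendsto (fun n : ℕ => 2 * n + 1) atTop atTop :=
    tendsto_atTop_mono (fun n => (by omega : n ≤ 2 * n + 1)) tendsto_id
  have h1 : Tendsto (fun n : ℕ => -1 * G (2 * n)) atTop (𝓝 L) :=
    (hlim.comp heven).congr fun n => by simp
  have h2 : Tendsto (fun n : ℕ => -2 * G (2 * n + 1)) atTop (𝓝 L) :=
    (hlim.comp hodd).congr fun n => by simp
  have e1 := tendsto_nhds_unique h1 ((hG.comp heven).const_mul (-1))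
  have e2 := tendsto_nhds_unique h2 ((hG.comp hodd).const_mul (-2))
  linarith

/-! ### The Bass stable rank of the Nevanlinna class -/

theorem isUnimodularTuple_fin_one_iff {A : Type*} [CommRing A] {f : Fin 1 → A} :
    IsUnimodularTuple f ↔ IsUnit (f 0) := by
  rw [IsUnimodularTuple, Set.range_unique, Ideal.span_singleton_eq_top]
  rfl

/-- A unimodular pair `(f, g)` such that no `f + φ g` is invertible forces the stable rank to be
at least `2`. -/
theorem two_le_bassStableRank {A : Type*} [CommRing A] {f g : A} (h : IsUnimodularTuple ![f, g])
    (hfg : ∀ φ, ¬ IsUnit (f + φ * g)) : 2 ≤ bassStableRank A := by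
  refine le_sInf ?_
  rintro _ ⟨n, rfl, hn, hred⟩
  rcases eq_or_lt_of_le hn with rfl | hn
  · obtain ⟨-, φ, hφ⟩ := hred ![f, g] h
    exact absurd (isUnimodularTuple_fin_one_iff.1 hφ) (hfg (φ 0))
  · exact_mod_cast hn

theorem IsNearbySequence.exists_isUnimodularTuple {μ : ℕ → 𝔻} (hμ : IsNearbySequence μ) :
    ∃ (h₁ : blaschkeFromOne dyadicPoint ∈ nevanlinnaClass)
      (h₂ : blaschkeFromOne μ ∈ nevanlinnaClass),
      IsUnimodularTuple
        ![(⟨blaschkeFromOne dyadicPoint, h₁⟩ : nevanlinnaClass), ⟨blaschkeFromOne μ, h₂⟩] ∧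
      ∀ φ : nevanlinnaClass,
        ¬ IsUnit ((⟨blaschkeFromOne dyadicPoint, h₁⟩ : nevanlinnaClass) +
          φ * ⟨blaschkeFromOne μ, h₂⟩) := by
  refine ⟨isBlaschkeSeq_dyadicZero.isNevanlinna, hμ.isBlaschkeSeq.isNevanlinna, ?_, ?_⟩
  · obtain ⟨f, g, hf, hg, hfg⟩ := hμ.exists_bezout
    rw [IsUnimodularTuple, Matrix.range_cons_cons_empty, Ideal.eq_top_iff_one,
      Ideal.mem_span_pair]
    exact ⟨⟨f, hf⟩, ⟨g, hg⟩, Subtype.ext (funext hfg)⟩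
  · intro φ hunit
    obtain ⟨v, hv⟩ := hunit.exists_right_inv
    have hv' : ∀ z : 𝔻, (blaschkeFromOne dyadicPoint z + φ.1 z * blaschkeFromOne μ z) * v.1 z = 1 :=
      fun z => congrFun (congrArg Subtype.val hv) z
    refine hμ.false_of_ne_zero_of_apply_eq
      (u := fun z => blaschkeFromOne dyadicPoint z + φ.1 z * blaschkeFromOne μ z)
      (IsNevanlinna.add isBlaschkeSeq_dyadicZero.isNevanlinna
        (IsNevanlinna.mul φ.2 hμ.isBlaschkeSeq.isNevanlinna))
      (fun z h0 => ?_) fun k hk => ?_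
    · have := hv' z
      rw [h0, zero_mul] at this
      exact zero_ne_one this
    · obtain ⟨j, rfl⟩ : ∃ j, k = j + 1 := ⟨k - 1, by omega⟩
      have h0 : blaschkeFromOne μ (μ (j + 1)) = 0 := hμ.isBlaschkeSeq.apply_eq_zero j
      rw [h0, mul_zero, add_zero]

theorem mainTheorem4 :
    2 ≤ bassStableRank nevanlinnaClass ∧
    (∃ μ : ℕ → Complex.UnitDisc, IsNearbySequence μ) ∧
    ∀ μ : ℕ → Complex.UnitDisc, IsNearbySequence μ →
      ∃ (h₁ : blaschkeFromOne dyadicPoint ∈ nevanlinnaClass)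
        (h₂ : blaschkeFromOne μ ∈ nevanlinnaClass),
        IsUnimodularTuple
          ![(⟨blaschkeFromOne dyadicPoint, h₁⟩ : nevanlinnaClass), ⟨blaschkeFromOne μ, h₂⟩] ∧
        ∀ φ : nevanlinnaClass,
          ¬ IsUnit ((⟨blaschkeFromOne dyadicPoint, h₁⟩ : nevanlinnaClass) +
            φ * ⟨blaschkeFromOne μ, h₂⟩) := by
  obtain ⟨μ, hμ⟩ := exists_isNearbySequence
  obtain ⟨h₁, h₂, huni, hred⟩ := hμ.exists_isUnimodularTuple
  exact ⟨two_le_bassStableRank huni hred, ⟨μ, hμ⟩, fun ν hν => hν.exists_isUnimodularTuple⟩
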